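/- For $\lambda\in\mathbb{R}$ let $e_\lambda(t)=e^{2\pi i\lambda t}$, and for $\Lambda\subseteq\mathbb{R}$ let $E(\Lambda)=\{e_\lambda\}_{\lambda\in\Lambda}$. A system of vectors in a Hilbert space $H$ is called a Riesz basis of $H$ if it is the image of an orthonormal basis of $H$ under a bounded invertible operator $H\to H$. Let $S_1\subseteq S_2\subseteq\dots\subseteq S_K\subseteq[0,1]$ be sets, each of which is a finite union of intervals. Then there exist sets $\Lambda_1\subseteq\Lambda_2\subseteq\dots\subseteq\Lambda_K\subseteq\mathbb{Z}$ such that, for every $k=1,\dots,K$, the system $E(\Lambda_k)$ is a Riesz basis of $L^2(S_k)$ (with respect to Lebesgue measure; if $S_k$ has measure zero, then $L^2(S_k)=\{0\}$ and the empty system counts as its Riesz basis). -/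

import Mathlib

open MeasureTheory

/-- A family `f` of vectors of an inner product space is a Riesz basis if it is the image of an
orthonormal (Hilbert) basis under a bounded invertible operator. -/
def IsRieszBasis {ι H : Type*} [NormedAddCommGroup H] [InnerProductSpace ℂ H] (f : ι → H) : Prop :=
  ∃ (b : HilbertBasis ι ℂ H) (T : H ≃L[ℂ] H), ∀ i, f i = T (b i)

/-- The exponential `e_x(t) = exp (2 π i x t)` of frequency `x`. -/
noncomputable def expFun (x t : ℝ) : ℂ :=
  Complex.exp (2 * Real.pi * Complex.I * x * t)

/-- The exponentials with frequencies `(freq i)` form a Riesz basis of `L²(S)`. The element `f i` of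
`L²(S)` is the class of the exponential of frequency `freq i`, which determines it. -/
def IsExpRieszBasis {ι : Type*} (freq : ι → ℝ) (S : Set ℝ) : Prop :=
  ∃ f : ι → Lp ℂ 2 (volume.restrict S),
    (∀ i, f i =ᵐ[volume.restrict S] expFun (freq i)) ∧ IsRieszBasis f

/-- A finite union of intervals of any kind (an order-connected subset of `ℝ` is an interval: open,
closed or half-open, possibly degenerate). -/
def IsFiniteUnionOfIntervals (S : Set ℝ) : Prop :=
  ∃ (L : ℕ) (I : Fin L → Set ℝ), (∀ l, (I l).OrdConnected) ∧ S = ⋃ l, I l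

/-! Regard each set as a subset of the circle, with a right-continuous indicator `f` that is a step
function. For `N > 0`, `fold N f` counts the points of the set in the fibre of `s ↦ N * s` above
`t`. The central fact is `rieszPair_of_fold`: if for every `n < N` the frequencies `Λ n` give a
Riesz basis on the superlevel set where the count exceeds `n`, then the union of the sets `N * Λ n +
n` gives one for the original set. Indeed the coefficients of `g` at `N * l + n` are, up to the
factor `N`, those of its fibre sum weighted by `e(-n s)`, and on a fibre meeting the set in `m`
points the first `m` weighted sums determine `g`, by Vandermonde. Folding and superlevel sets
respect inclusion, so nested bases downstairs give nested bases upstairs, provided that one `N`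
serves the whole chain.

The induction is on the number of jumps, summed over the chain (`hasNestedBases`). It needs an `N`
for which every superlevel set of the folding of one given set with at least four jumps has strictly
fewer jumps (`IsStep.exists_fold_totalJump_lt`). If two jumps of opposite sign lie at rational
distance, some `N` makes them collide and cancel. Otherwise, suppose that for each `N` some level
keeps all the jumps. Then the folding takes only two adjacent values, its variance is at most `1/4`,
and Parseval bounds the coefficients of its jump measure at `1` and `2`
(`jumpSum_le_of_two_valued`). Averaging over `N` makes these coefficients too large, because `4 +
4/4 = 5 > π² / 2` (`exists_large_jumpSum`).

What remains is a chain of arcs (`hasNestedBases_of_arcs`). Folding an arc of length `β` gives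
levels that are arcs of length `N * β - n`, clamped to the unit interval. For large `N` and two
different lengths, at each level the shorter arc has become empty or the longer one has become the
full circle, so nestedness is automatic. For a single arc, Dirichlet's theorem supplies an `N` whose
levels are empty, full or of length at most `1/10`. On such a short arc, rounding `n / β` to
integers perturbs the orthogonal frequencies so little that a Neumann series applies
(`exists_rieszPair_smallArc`).

Throughout, a Riesz basis is handled as the bijectivity of the map from functions to coefficients;
`isRieszBasis_of_bijective` converts this by polar decomposition. -/

open Filter Topology

/-! ### Step functions on the circle and their jumps. -/

/-- The sum of `f` over the fibre of `s ↦ N * s` (modulo one) above `t`. -/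
noncomputable def fold (N : ℕ) (f : ℝ → ℤ) (t : ℝ) : ℤ := ∑ j ∈ Finset.range N, f ((t + j) / N)

/-- The indicator of the superlevel set `n < F`. -/
def level (n : ℕ) (F : ℝ → ℤ) (t : ℝ) : ℤ := if (n : ℤ) < F t then 1 else 0

/-- `f` is locally constant on both sides of `x`, continuous from the right, and jumps by `d`. -/
def HasJump (f : ℝ → ℤ) (x : ℝ) (d : ℤ) : Prop :=
  (∀ᶠ y in 𝓝[<] x, f y = f x - d) ∧ ∀ᶠ y in 𝓝[>] x, f y = f x

/-- Right-continuous integer-valued step functions of period one. -/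
structure IsStep (f : ℝ → ℤ) : Prop where
  periodic : Function.Periodic f 1
  hasJump : ∀ x, ∃ d, HasJump f x d

namespace HasJump

theorem unique {f : ℝ → ℤ} {x : ℝ} {d e : ℤ} (h : HasJump f x d) (h' : HasJump f x e) :
    d = e := by
  obtain ⟨y, h1, h2⟩ := (h.1.and h'.1).exists
  omega

theorem const (c : ℤ) (x : ℝ) : HasJump (fun _ => c) x 0 := by
  constructor <;> simp

theorem add {f g : ℝ → ℤ} {x : ℝ} {d e : ℤ} (h : HasJump f x d) (h' : HasJump g x e) :
    HasJump (fun t => f t + g t) x (d + e) := by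
  constructor
  · filter_upwards [h.1, h'.1] with y h1 h2
    rw [h1, h2]; ring
  · filter_upwards [h.2, h'.2] with y h1 h2
    rw [h1, h2]

theorem const_mul {f : ℝ → ℤ} {x : ℝ} {d : ℤ} (c : ℤ) (h : HasJump f x d) :
    HasJump (fun t => c * f t) x (c * d) := by
  constructor
  · filter_upwards [h.1] with y h1
    rw [h1]; ring
  · filter_upwards [h.2] with y h1
    rw [h1]

theorem sum {ι : Type*} (X : Finset ι) {f : ι → ℝ → ℤ} {x : ℝ} {d : ι → ℤ}
    (h : ∀ i ∈ X, HasJump (f i) x (d i)) :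
    HasJump (fun t => ∑ i ∈ X, f i t) x (∑ i ∈ X, d i) := by
  classical
  induction X using Finset.induction_on with
  | empty => simpa using const 0 x
  | insert a s ha ih =>
    simp only [Finset.sum_insert ha]
    exact (h a (Finset.mem_insert_self a s)).add
      (ih fun i hi => h i (Finset.mem_insert_of_mem hi))

theorem floor_sub (p y : ℝ) :
    HasJump (fun t => ⌊t - p⌋) y (if Int.fract (y - p) = 0 then 1 else 0) := by
  have hfl := Int.floor_le (y - p)
  have hlt := Int.lt_floor_add_one (y - p)
  constructor
  · split_ifs with h
    · have hy : (⌊y - p⌋ : ℝ) = y - p := by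
        have := Int.floor_add_fract (y - p); rw [h] at this; linarith
      filter_upwards [Ioo_mem_nhdsLT (show y - 1 < y by linarith)] with t ht
      rw [Int.floor_eq_iff]
      push_cast
      constructor <;> linarith [ht.1, ht.2]
    · have hy : (⌊y - p⌋ : ℝ) < y - p := by
        have := Int.floor_add_fract (y - p)
        have h2 := lt_of_le_of_ne (Int.fract_nonneg (y - p)) (Ne.symm h)
        linarith
      filter_upwards [Ioo_mem_nhdsLT (show p + ⌊y - p⌋ < y by linarith)] with t ht
      rw [Int.floor_eq_iff]
      push_cast
      constructor <;> linarith [ht.1, ht.2]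
  · filter_upwards [Ioo_mem_nhdsGT (show y < p + ⌊y - p⌋ + 1 by linarith)] with t ht
    rw [Int.floor_eq_iff]
    constructor <;> linarith [ht.1, ht.2]

theorem eventually_eq {f : ℝ → ℤ} {x : ℝ} (h : HasJump f x 0) : ∀ᶠ y in 𝓝 x, f y = f x := by
  have h1 := h.1
  simp only [sub_zero] at h1
  have h3 : ∀ᶠ y in 𝓝[≠] x, f y = f x := by
    rw [← nhdsLT_sup_nhdsGT]
    exact Filter.eventually_sup.2 ⟨h1, h.2⟩
  rw [eventually_nhdsWithin_iff] at h3
  filter_upwards [h3] with y hy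
  by_cases hyx : y = x
  · rw [hyx]
  · exact hy hyx

/-- Points near `x`, other than `x`, are not jump points. -/
theorem eventually_zero {f : ℝ → ℤ} {x : ℝ} {d : ℤ} (h : HasJump f x d) :
    ∀ᶠ y in 𝓝[≠] x, HasJump f y 0 := by
  have key : ∀ (U : Set ℝ) (v : ℤ), IsOpen U → (∀ y ∈ U, f y = v) → ∀ y ∈ U, HasJump f y 0 := by
    intro U v hU hv y hy
    have : ∀ᶠ z in 𝓝 y, f z = f y := by
      filter_upwards [hU.mem_nhds hy] with z hz
      rw [hv z hz, hv y hy]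
    constructor
    · simp only [sub_zero]
      exact this.filter_mono nhdsWithin_le_nhds
    · exact this.filter_mono nhdsWithin_le_nhds
  rw [← nhdsLT_sup_nhdsGT]
  refine Filter.eventually_sup.2 ⟨?_, ?_⟩
  · obtain ⟨a, ha, hs⟩ := (mem_nhdsLT_iff_exists_Ioo_subset).1 h.1
    filter_upwards [Ioo_mem_nhdsLT ha] with y hy
    exact key (Set.Ioo a x) _ isOpen_Ioo (fun z hz => hs hz) y hy
  · obtain ⟨a, ha, hs⟩ := (mem_nhdsGT_iff_exists_Ioo_subset).1 h.2
    filter_upwards [Ioo_mem_nhdsGT ha] with y hy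
    exact key (Set.Ioo x a) _ isOpen_Ioo (fun z hz => hs hz) y hy

end HasJump

theorem eq_of_hasJump_zero {f : ℝ → ℤ} (h : ∀ x, HasJump f x 0) (s t : ℝ) : f s = f t :=
  ((IsLocallyConstant.iff_eventually_eq f).2 fun x => (h x).eventually_eq).apply_eq_of_preconnectedSpace
    s t

/-- The jump of a step function at a point. -/
noncomputable def jump (f : ℝ → ℤ) (x : ℝ) : ℤ := Classical.epsilon (HasJump f x)

theorem HasJump.jump_eq {f : ℝ → ℤ} {x : ℝ} {d : ℤ} (h : HasJump f x d) : jump f x = d :=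
  HasJump.unique (Classical.epsilon_spec (p := HasJump f x) ⟨d, h⟩) h

theorem IsStep.hasJump_jump {f : ℝ → ℤ} (hf : IsStep f) (x : ℝ) : HasJump f x (jump f x) :=
  Classical.epsilon_spec (p := HasJump f x) (hf.hasJump x)

theorem HasJump.add_int {f : ℝ → ℤ} (hf : Function.Periodic f 1) {x : ℝ} {d : ℤ}
    (h : HasJump f x d) (k : ℤ) : HasJump f (x + k) d := by
  have hp : ∀ y, f (y - k) = f y := fun y => by simpa using hf.sub_int_mul_eq k (x := y)
  have hx : f (x + k) = f x := by simpa using hf.int_mul k x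
  have ht : Tendsto (fun y : ℝ => y - k) (𝓝 (x + k)) (𝓝 x) := by
    have : Continuous fun y : ℝ => y - k := by fun_prop
    simpa using this.tendsto (x + k)
  constructor
  · have := (tendsto_nhdsWithin_of_tendsto_nhds_of_eventually_within (s := Set.Iio x) _
      (ht.mono_left (nhdsWithin_le_nhds (s := Set.Iio (x + k)))) (by
        filter_upwards [self_mem_nhdsWithin] with y hy
        simp only [Set.mem_Iio] at *; linarith)).eventually h.1
    filter_upwards [this] with y hy
    rw [hx, ← hy, hp]
  · have := (tendsto_nhdsWithin_of_tendsto_nhds_of_eventually_within (s := Set.Ioi x) _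
      (ht.mono_left (nhdsWithin_le_nhds (s := Set.Ioi (x + k)))) (by
        filter_upwards [self_mem_nhdsWithin] with y hy
        simp only [Set.mem_Ioi] at *; linarith)).eventually h.2
    filter_upwards [this] with y hy
    rw [hx, ← hy, hp]

theorem IsStep.jump_fract {f : ℝ → ℤ} (hf : IsStep f) (x : ℝ) :
    jump f (Int.fract x) = jump f x := by
  have := ((hf.hasJump_jump (Int.fract x)).add_int hf.periodic ⌊x⌋).jump_eq
  rw [Int.fract_add_floor] at this
  exact this.symm

/-- Infinitely many jumps would accumulate at some `x`, whereas a step function is constant on each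
side of `x`. -/
theorem IsStep.finite_jumps {f : ℝ → ℤ} (hf : IsStep f) :
    {x ∈ Set.Ico (0 : ℝ) 1 | jump f x ≠ 0}.Finite := by
  by_contra hinf
  obtain ⟨x, -, hx⟩ := Set.Infinite.exists_accPt_of_subset_isCompact hinf
    (isCompact_Icc (a := (0 : ℝ)) (b := 1))
    fun x hx => Set.Ico_subset_Icc_self hx.1
  rw [accPt_iff_frequently_nhdsNE] at hx
  refine hx ?_
  filter_upwards [(hf.hasJump_jump x).eventually_zero] with y hy hy'
  exact hy'.2 hy.jump_eq

/-- The jump points of a step function in `[0, 1)`. -/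
noncomputable def IsStep.jumps {f : ℝ → ℤ} (hf : IsStep f) : Finset ℝ := hf.finite_jumps.toFinset

theorem IsStep.mem_jumps {f : ℝ → ℤ} (hf : IsStep f) {x : ℝ} :
    x ∈ hf.jumps ↔ x ∈ Set.Ico (0 : ℝ) 1 ∧ jump f x ≠ 0 := by
  simp [IsStep.jumps]

/-- The total size of the jumps of a step function over one period. -/
noncomputable def totalJump (f : ℝ → ℤ) : ℕ := ∑ᶠ x ∈ Set.Ico (0 : ℝ) 1, (jump f x).natAbs

theorem totalJump_eq_sum {f : ℝ → ℤ} (Y : Finset ℝ) (hY : ∀ y ∈ Y, y ∈ Set.Ico (0 : ℝ) 1)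
    (h : ∀ x ∈ Set.Ico (0 : ℝ) 1, jump f x ≠ 0 → x ∈ Y) :
    totalJump f = ∑ x ∈ Y, (jump f x).natAbs := by
  refine finsum_mem_eq_sum_of_inter_support_eq _ ?_
  ext x
  simp only [Set.mem_inter_iff, Function.mem_support, Finset.mem_coe, ne_eq, Int.natAbs_eq_zero]
  exact ⟨fun ⟨h1, h2⟩ => ⟨h x h1 h2, h2⟩, fun ⟨h1, h2⟩ => ⟨hY x h1, h2⟩⟩

theorem IsStep.totalJump_eq {f : ℝ → ℤ} (hf : IsStep f) :
    totalJump f = ∑ x ∈ hf.jumps, (jump f x).natAbs :=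
  totalJump_eq_sum _ (fun _ hy => (hf.mem_jumps.1 hy).1) fun _ hx h => hf.mem_jumps.2 ⟨hx, h⟩

/-- Integer combinations of translated floor functions. -/
noncomputable def stair {ι : Type*} (X : Finset ι) (w : ι → ℤ) (p : ι → ℝ) (c : ℤ) (t : ℝ) : ℤ :=
  c + ∑ x ∈ X, w x * ⌊t - p x⌋

section stair

variable {ι : Type*} (X : Finset ι) (w : ι → ℤ) (p : ι → ℝ) (c : ℤ)

theorem hasJump_stair (y : ℝ) : HasJump (stair X w p c) y
    (∑ x ∈ X, w x * (if Int.fract (y - p x) = 0 then 1 else 0)) := by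
  have := (HasJump.const c y).add
    (HasJump.sum X fun x _ => (HasJump.floor_sub (p x) y).const_mul (w x))
  rw [zero_add] at this
  exact this

theorem stair_add_one (t : ℝ) : stair X w p c (t + 1) = stair X w p c t + ∑ x ∈ X, w x := by
  unfold stair
  rw [add_assoc, ← Finset.sum_add_distrib]
  congr 1
  refine Finset.sum_congr rfl fun x _ => ?_
  rw [show t + 1 - p x = t - p x + 1 by ring, Int.floor_add_one]; ring

theorem isStep_stair (hw : ∑ x ∈ X, w x = 0) : IsStep (stair X w p c) :=
  ⟨fun t => by rw [stair_add_one, hw, add_zero], fun x => ⟨_, hasJump_stair X w p c x⟩⟩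

theorem fract_sub_eq_zero_iff {y q : ℝ} (hy : y ∈ Set.Ico (0 : ℝ) 1) :
    Int.fract (y - q) = 0 ↔ y = Int.fract q := by
  rw [Int.fract_eq_zero_iff]
  constructor
  · rintro ⟨k, hk⟩
    have hq : q = y - k := by rw [hk]; ring
    rw [hq, Int.fract_sub_intCast, Int.fract_eq_self.2 hy]
  · intro h
    refine ⟨-⌊q⌋, ?_⟩
    rw [h, Int.fract]; push_cast; ring

/-- Only an inequality: points `p x` that agree modulo one merge, and their weights may cancel. -/
theorem totalJump_stair_le : totalJump (stair X w p c) ≤ ∑ x ∈ X, (w x).natAbs := by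
  classical
  set Y : Finset ℝ := X.image fun x => Int.fract (p x) with hYdef
  have hY : ∀ y ∈ Y, y ∈ Set.Ico (0 : ℝ) 1 := by
    intro y hy
    obtain ⟨x, -, rfl⟩ := Finset.mem_image.1 hy
    exact ⟨Int.fract_nonneg _, Int.fract_lt_one _⟩
  have hj : ∀ y ∈ Set.Ico (0 : ℝ) 1, jump (stair X w p c) y =
      ∑ x ∈ X, w x * (if y = Int.fract (p x) then 1 else 0) := by
    intro y hy
    rw [(hasJump_stair X w p c y).jump_eq]
    simp only [fract_sub_eq_zero_iff hy]
  rw [totalJump_eq_sum Y hY]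
  · calc ∑ y ∈ Y, (jump (stair X w p c) y).natAbs
        ≤ ∑ y ∈ Y, ∑ x ∈ X, (if y = Int.fract (p x) then (w x).natAbs else 0) := by
          refine Finset.sum_le_sum fun y hy => ?_
          rw [hj y (hY y hy)]
          refine (Int.natAbs_sum_le _ _).trans (Finset.sum_le_sum fun x _ => ?_)
          split_ifs <;> simp
      _ = ∑ x ∈ X, ∑ y ∈ Y, (if y = Int.fract (p x) then (w x).natAbs else 0) :=
          Finset.sum_comm
      _ ≤ ∑ x ∈ X, (w x).natAbs := by
          refine Finset.sum_le_sum fun x _ => ?_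
          rw [Finset.sum_ite_eq']
          split_ifs <;> simp
  · intro y hy hne
    rw [hj y hy] at hne
    obtain ⟨x, hx, hx'⟩ := Finset.exists_ne_zero_of_sum_ne_zero hne
    refine Finset.mem_image.2 ⟨x, hx, ?_⟩
    by_contra h
    exact hx' (by rw [if_neg (Ne.symm h), mul_zero])

end stair

/-- Subtracting the staircase with the same jumps leaves a function without jumps, which is constant
by connectedness of the line. This normal form makes folding explicit. -/
theorem IsStep.eq_stair {f : ℝ → ℤ} (hf : IsStep f) :
    ∃ c, f = stair hf.jumps (jump f) id c := by
  have h0 : ∀ y, HasJump (fun t => f t + (-1) * stair hf.jumps (jump f) id 0 t) y 0 := by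
    intro y
    have h := (hf.hasJump_jump y).add ((hasJump_stair hf.jumps (jump f) id 0 y).const_mul (-1))
    convert h using 1
    have hs : ∑ x ∈ hf.jumps, jump f x * (if Int.fract (y - id x) = 0 then 1 else 0) =
        jump f y := by
      rw [← hf.jump_fract y]
      have : ∀ x ∈ hf.jumps, jump f x * (if Int.fract (y - id x) = 0 then 1 else 0) =
          if x = Int.fract y then jump f x else 0 := by
        intro x hx
        have : (Int.fract (y - x) = 0) ↔ x = Int.fract y := by
          rw [← fract_sub_eq_zero_iff (hf.mem_jumps.1 hx).1, Int.fract_eq_zero_iff,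
            Int.fract_eq_zero_iff]
          constructor <;> rintro ⟨k, hk⟩ <;> exact ⟨-k, by push_cast; linarith⟩
        simp only [id, this, mul_ite, mul_one, mul_zero]
      rw [Finset.sum_congr rfl this, Finset.sum_ite_eq']
      split_ifs with h
      · rfl
      · by_contra h'
        exact h (hf.mem_jumps.2 ⟨⟨Int.fract_nonneg _, Int.fract_lt_one _⟩, Ne.symm h'⟩)
    rw [hs]; ring
  refine ⟨f 0 + (-1) * stair hf.jumps (jump f) id 0 0, funext fun t => ?_⟩
  have := eq_of_hasJump_zero h0 t 0
  simp only [stair] at this ⊢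
  linarith

theorem IsStep.sum_jump {f : ℝ → ℤ} (hf : IsStep f) : ∑ x ∈ hf.jumps, jump f x = 0 := by
  obtain ⟨c, hc⟩ := hf.eq_stair
  have h1 := hf.periodic 0
  have h2 := stair_add_one hf.jumps (jump f) id c 0
  rw [← hc] at h2
  omega

theorem IsStep.measurable {f : ℝ → ℤ} (hf : IsStep f) : Measurable f := by
  obtain ⟨c, hc⟩ := hf.eq_stair
  rw [hc]
  unfold stair
  refine measurable_const.add (Finset.measurable_sum _ fun x _ => ?_)
  exact (Int.measurable_floor.comp (measurable_id.sub_const _)).const_mul _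

/-! ### Jumps of foldings and of superlevel sets. -/

theorem sum_range_int_add_ediv (N : ℕ) (hN : 0 < N) (m : ℤ) :
    ∑ j ∈ Finset.range N, (m + j) / (N : ℤ) = m := by
  have hN' : (N : ℤ) ≠ 0 := by omega
  have step : ∀ m : ℤ, ∑ j ∈ Finset.range N, (m + 1 + j) / (N : ℤ) =
      ∑ j ∈ Finset.range N, (m + j) / (N : ℤ) + 1 := by
    intro m
    have h1 := Finset.sum_range_succ (fun j : ℕ => (m + j) / (N : ℤ)) N
    have h2 := Finset.sum_range_succ' (fun j : ℕ => (m + j) / (N : ℤ)) N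
    have h3 : (m + N) / (N : ℤ) = m / N + 1 := Int.add_ediv_of_dvd_right (dvd_refl _) |>.trans
      (by rw [Int.ediv_self hN'])
    have h4 : ∑ j ∈ Finset.range N, (m + 1 + j) / (N : ℤ) =
        ∑ j ∈ Finset.range N, (m + (j + 1 : ℕ)) / (N : ℤ) := by
      refine Finset.sum_congr rfl fun j _ => ?_
      push_cast; congr 1; ring
    simp only [Nat.cast_zero, add_zero] at h2
    omega
  induction m using Int.induction_on with
  | zero =>
    refine Finset.sum_eq_zero fun j hj => ?_
    rw [zero_add]
    exact Int.ediv_eq_zero_of_lt (by omega) (by exact_mod_cast Finset.mem_range.1 hj)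
  | succ i ih => rw [step, ih]
  | pred i ih =>
    have := step (-(i : ℤ) - 1)
    rw [sub_add_cancel, ih] at this
    omega

/-- Hermite's identity for the floor function, reduced to integers by removing fractional parts. -/
theorem sum_floor_div (N : ℕ) (hN : 0 < N) (t x : ℝ) :
    ∑ j ∈ Finset.range N, ⌊(t + j) / N - x⌋ = ⌊t - N * x⌋ := by
  have hN' : (N : ℝ) ≠ 0 := by positivity
  rw [← sum_range_int_add_ediv N hN ⌊t - N * x⌋]
  refine Finset.sum_congr rfl fun j _ => ?_
  rw [show (t + j) / N - x = (t - N * x + j) / N by field_simp; ring, Int.floor_div_natCast,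
    Int.floor_add_natCast]

/-- Folding moves the jump points by multiplication by `N` and keeps their weights. -/
theorem fold_stair {ι : Type*} (X : Finset ι) (w : ι → ℤ) (p : ι → ℝ) (c : ℤ) (N : ℕ)
    (hN : 0 < N) : fold N (stair X w p c) = stair X w (fun x => N * p x) (N * c) := by
  ext t
  unfold fold stair
  rw [Finset.sum_add_distrib, Finset.sum_comm]
  congr 1
  · simp
  · refine Finset.sum_congr rfl fun x _ => ?_
    rw [← Finset.mul_sum, sum_floor_div N hN]

theorem IsStep.fold {f : ℝ → ℤ} (hf : IsStep f) {N : ℕ} (hN : 0 < N) : IsStep (fold N f) := by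
  obtain ⟨c, hc⟩ := hf.eq_stair
  rw [hc, fold_stair _ _ _ _ N hN]
  exact isStep_stair _ _ _ _ hf.sum_jump

theorem IsStep.totalJump_fold_le {f : ℝ → ℤ} (hf : IsStep f) {N : ℕ} (hN : 0 < N) :
    totalJump (_root_.fold N f) ≤ totalJump f := by
  obtain ⟨c, hc⟩ := hf.eq_stair
  rw [hf.totalJump_eq]
  conv_lhs => rw [hc, fold_stair _ _ _ _ N hN]
  exact totalJump_stair_le _ _ _ _

theorem HasJump.level {F : ℝ → ℤ} {x : ℝ} {d : ℤ} (h : HasJump F x d) (n : ℕ) :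
    HasJump (level n F) x
      ((if (n : ℤ) < F x then 1 else 0) - if (n : ℤ) < F x - d then 1 else 0) := by
  unfold _root_.level
  constructor
  · filter_upwards [h.1] with y hy
    rw [hy]; ring
  · filter_upwards [h.2] with y hy
    rw [hy]

theorem IsStep.level {F : ℝ → ℤ} (hF : IsStep F) (n : ℕ) : IsStep (level n F) :=
  ⟨fun t => by unfold _root_.level; rw [hF.periodic t], fun x => ⟨_, (hF.hasJump_jump x).level n⟩⟩

theorem level_mem (n : ℕ) (F : ℝ → ℤ) (t : ℝ) : level n F t = 0 ∨ level n F t = 1 := by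
  unfold level; split_ifs <;> simp

/-- A jump of size `d` crosses `|d|` integer levels and produces a unit jump in each of them, so two
different levels together receive at most `|d|`. -/
theorem IsStep.totalJump_level_add_le {F : ℝ → ℤ} (hF : IsStep F) {n m : ℕ} (hnm : n ≠ m) :
    totalJump (_root_.level n F) + totalJump (_root_.level m F) ≤ totalJump F := by
  have hj : ∀ k x, jump (_root_.level k F) x =
      (if (k : ℤ) < F x then 1 else 0) - if (k : ℤ) < F x - jump F x then 1 else 0 :=
    fun k x => ((hF.hasJump_jump x).level k).jump_eq
  have hsub : ∀ k, ∀ x ∈ Set.Ico (0 : ℝ) 1, jump (_root_.level k F) x ≠ 0 → x ∈ hF.jumps := by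
    intro k x hx h
    refine hF.mem_jumps.2 ⟨hx, fun h0 => h ?_⟩
    rw [hj, h0]; simp
  have hI : ∀ y ∈ hF.jumps, y ∈ Set.Ico (0 : ℝ) 1 := fun y hy => (hF.mem_jumps.1 hy).1
  rw [hF.totalJump_eq, totalJump_eq_sum _ hI (hsub n), totalJump_eq_sum _ hI (hsub m),
    ← Finset.sum_add_distrib]
  refine Finset.sum_le_sum fun x _ => ?_
  rw [hj, hj]
  split_ifs <;> omega

theorem IsStep.totalJump_level_le {F : ℝ → ℤ} (hF : IsStep F) (n : ℕ) :
    totalJump (_root_.level n F) ≤ totalJump F :=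
  (Nat.le_add_right _ _).trans (hF.totalJump_level_add_le (Nat.ne_of_lt (Nat.lt_succ_self n)))

theorem IsStep.eq_const_of_totalJump {f : ℝ → ℤ} (hf : IsStep f) (h : totalJump f = 0) :
    ∃ c, ∀ t, f t = c := by
  obtain ⟨c, hc⟩ := hf.eq_stair
  have h0 : ∀ x ∈ hf.jumps, jump f x = 0 := by
    rw [hf.totalJump_eq, Finset.sum_eq_zero_iff] at h
    exact fun x hx => Int.natAbs_eq_zero.1 (h x hx)
  refine ⟨c, fun t => ?_⟩
  rw [hc, stair, Finset.sum_eq_zero, add_zero]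
  intro x hx
  rw [h0 x hx, zero_mul]

/-! ### Characters and Fourier coefficients of periodic functions. -/

/-- The conjugate exponential `e(-n t)`. -/
noncomputable def chr (n : ℤ) (t : ℝ) : ℂ := Complex.exp (-(2 * Real.pi * Complex.I * n * t))

theorem chr_add_int (n : ℤ) (t : ℝ) (k : ℤ) : chr n (t + k) = chr n t := by
  unfold chr
  rw [Complex.exp_eq_exp_iff_exists_int]
  exact ⟨-(n * k), by push_cast; ring⟩

theorem chr_add (n : ℤ) (s t : ℝ) : chr n (s + t) = chr n s * chr n t := by
  unfold chr
  rw [← Complex.exp_add]; push_cast; ring_nf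

theorem chr_index_add (m n : ℤ) (t : ℝ) : chr (m + n) t = chr m t * chr n t := by
  unfold chr
  rw [← Complex.exp_add]; push_cast; ring_nf

theorem chr_mul_nat (N : ℕ) (n : ℤ) (t : ℝ) : chr (N * n) t = chr n (N * t) := by
  unfold chr
  push_cast; ring_nf

theorem chr_natCast (n : ℕ) (t : ℝ) : chr n t = chr 1 t ^ n := by
  unfold chr
  rw [← Complex.exp_nat_mul]; push_cast; ring_nf

@[simp] theorem norm_chr (n : ℤ) (t : ℝ) : ‖chr n t‖ = 1 := by
  have : chr n t = Complex.exp (((-(2 * Real.pi * n * t) : ℝ) : ℂ) * Complex.I) := by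
    unfold chr; push_cast; ring_nf
  rw [this, Complex.norm_exp_ofReal_mul_I]

theorem chr_ne_zero (n : ℤ) (t : ℝ) : chr n t ≠ 0 := Complex.exp_ne_zero _

theorem continuous_chr (n : ℤ) : Continuous (chr n) := by unfold chr; fun_prop

theorem measurable_chr (n : ℤ) : Measurable (chr n) := (continuous_chr n).measurable

theorem periodic_chr (n : ℤ) : Function.Periodic (chr n) 1 := fun t => by
  simpa using chr_add_int n t 1

/-- Measurable functions of period one that are square integrable over a period. -/
structure L2per (g : ℝ → ℂ) : Prop where
  measurable : Measurable g
  periodic : Function.Periodic g 1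
  integrable_sq : IntervalIntegrable (fun t => ‖g t‖ ^ 2) volume 0 1

/-- The Fourier coefficients of a function of period one. -/
noncomputable def fc (g : ℝ → ℂ) (n : ℤ) : ℂ := ∫ t in (0 : ℝ)..1, g t * chr n t

namespace L2per

theorem memLp {g : ℝ → ℂ} (hg : L2per g) : MemLp g 2 (volume.restrict (Set.Ioc (0 : ℝ) 1)) := by
  rw [memLp_two_iff_integrable_sq_norm hg.measurable.aestronglyMeasurable]
  exact (intervalIntegrable_iff_integrableOn_Ioc_of_le zero_le_one).1 hg.integrable_sq

theorem of_memLp {g : ℝ → ℂ} (hm : Measurable g) (hp : Function.Periodic g 1)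
    (h : MemLp g 2 (volume.restrict (Set.Ioc (0 : ℝ) 1))) : L2per g := by
  refine ⟨hm, hp, (intervalIntegrable_iff_integrableOn_Ioc_of_le zero_le_one).2 ?_⟩
  exact (memLp_two_iff_integrable_sq_norm hm.aestronglyMeasurable).1 h

theorem zero : L2per (fun _ => 0) :=
  of_memLp measurable_const (fun _ => rfl) MemLp.zero'

theorem add {g h : ℝ → ℂ} (hg : L2per g) (hh : L2per h) : L2per (fun t => g t + h t) :=
  of_memLp (hg.measurable.add hh.measurable) (fun t => by rw [hg.periodic, hh.periodic])
    (hg.memLp.add hh.memLp)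

theorem sub {g h : ℝ → ℂ} (hg : L2per g) (hh : L2per h) : L2per (fun t => g t - h t) :=
  of_memLp (hg.measurable.sub hh.measurable) (fun t => by rw [hg.periodic, hh.periodic])
    (hg.memLp.sub hh.memLp)

theorem bdd_mul {g φ : ℝ → ℂ} (hg : L2per g) (hφ : Measurable φ) (hp : Function.Periodic φ 1)
    (C : ℝ) (hC : ∀ t, ‖φ t‖ ≤ C) : L2per (fun t => φ t * g t) := by
  refine of_memLp (hφ.mul hg.measurable) (fun t => by rw [hg.periodic, hp]) ?_
  refine hg.memLp.of_le_mul (c := C) (hφ.mul hg.measurable).aestronglyMeasurable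
    (Eventually.of_forall fun t => ?_)
  rw [norm_mul]
  exact mul_le_mul_of_nonneg_right (hC t) (norm_nonneg _)

theorem intervalIntegrable_sq {g : ℝ → ℂ} (hg : L2per g) (a b : ℝ) :
    IntervalIntegrable (fun t => ‖g t‖ ^ 2) volume a b :=
  Function.Periodic.intervalIntegrable₀ (T := 1) (fun t => by simp only [hg.periodic t])
    one_ne_zero hg.integrable_sq a b

theorem intervalIntegrable {g : ℝ → ℂ} (hg : L2per g) (a b : ℝ) :
    IntervalIntegrable g volume a b := by
  refine Function.Periodic.intervalIntegrable₀ hg.periodic one_ne_zero ?_ a b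
  exact (intervalIntegrable_iff_integrableOn_Ioc_of_le zero_le_one).2
    (hg.memLp.integrable one_le_two)

theorem mul_chr {g : ℝ → ℂ} (hg : L2per g) (n : ℤ) : L2per (fun t => g t * chr n t) := by
  simp only [mul_comm (g _)]
  exact hg.bdd_mul (measurable_chr n) (periodic_chr n) 1 fun t => (norm_chr n t).le

theorem fc_add {g h : ℝ → ℂ} (hg : L2per g) (hh : L2per h) (n : ℤ) :
    fc (fun t => g t + h t) n = fc g n + fc h n := by
  unfold fc
  rw [← intervalIntegral.integral_add ((hg.mul_chr n).intervalIntegrable 0 1)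
    ((hh.mul_chr n).intervalIntegrable 0 1)]
  simp only [add_mul]

theorem fc_sub {g h : ℝ → ℂ} (hg : L2per g) (hh : L2per h) (n : ℤ) :
    fc (fun t => g t - h t) n = fc g n - fc h n := by
  unfold fc
  rw [← intervalIntegral.integral_sub ((hg.mul_chr n).intervalIntegrable 0 1)
    ((hh.mul_chr n).intervalIntegrable 0 1)]
  simp only [sub_mul]

end L2per

theorem fourierCoeffOn_eq_fc (g : ℝ → ℂ) (n : ℤ) : fourierCoeffOn zero_lt_one g n = fc g n := by
  rw [fourierCoeffOn_eq_integral, fc]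
  simp only [sub_zero, div_one, one_smul]
  refine intervalIntegral.integral_congr fun t _ => ?_
  simp only [fourier_coe_apply, smul_eq_mul, chr]
  rw [mul_comm]
  congr 2
  push_cast; ring

theorem hasSum_sq_fc_of_memLp {g : ℝ → ℂ} (hg : MemLp g 2 (volume.restrict (Set.Ioc (0 : ℝ) 1))) :
    HasSum (fun n => ‖fc g n‖ ^ 2) (∫ t in (0 : ℝ)..1, ‖g t‖ ^ 2) := by
  have := hasSum_sq_fourierCoeffOn zero_lt_one hg
  simpa [fourierCoeffOn_eq_fc] using this

theorem L2per.summable_sq_fc {g : ℝ → ℂ} (hg : L2per g) : Summable fun n => ‖fc g n‖ ^ 2 :=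
  (hasSum_sq_fc_of_memLp hg.memLp).summable

theorem ae_of_ae_restrict_Ioc {P : ℝ → Prop} (hP : ∀ t, P (t + 1) ↔ P t)
    (h : ∀ᵐ t ∂volume.restrict (Set.Ioc (0 : ℝ) 1), P t) : ∀ᵐ t, P t := by
  have hk : ∀ (k : ℤ) t, P (t - k) ↔ P t := by
    have : Function.Periodic P 1 := fun t => propext (hP t)
    intro k t
    have := this.sub_int_mul_eq k (x := t)
    rw [mul_one] at this
    rw [this]
  rw [ae_restrict_iff' measurableSet_Ioc] at h
  have h2 : ∀ k : ℤ, ∀ᵐ t, t - (k : ℝ) ∈ Set.Ioc (0 : ℝ) 1 → P (t - k) := fun k =>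
    (measurePreserving_sub_right volume (k : ℝ)).quasiMeasurePreserving.ae h
  filter_upwards [ae_all_iff.2 h2] with t ht
  rw [← hk (⌈t⌉ - 1)]
  refine ht _ ?_
  push_cast
  constructor <;> linarith [Int.ceil_lt_add_one t, Int.le_ceil t]

theorem L2per.ae_eq_zero {g : ℝ → ℂ} (hg : L2per g) (h : ∀ n, fc g n = 0) : ∀ᵐ t, g t = 0 := by
  refine ae_of_ae_restrict_Ioc (fun t => by rw [hg.periodic]) ?_
  have h1 := hasSum_sq_fc_of_memLp hg.memLp
  simp only [h, norm_zero, ne_eq, OfNat.ofNat_ne_zero, not_false_eq_true, zero_pow] at h1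
  have h2 := h1.unique hasSum_zero
  rw [intervalIntegral.integral_of_le zero_le_one, integral_eq_zero_iff_of_nonneg
    (fun t => by positivity) ((intervalIntegrable_iff_integrableOn_Ioc_of_le zero_le_one).1
      hg.integrable_sq)] at h2
  filter_upwards [h2] with t ht
  simpa using ht

/-- Riesz–Fischer: every square summable sequence is a sequence of Fourier coefficients. -/
theorem exists_L2per_fc_eq (c : lp (fun _ : ℤ => ℂ) 2) : ∃ g, L2per g ∧ ∀ n, fc g n = c n := by
  have : Fact ((0 : ℝ) < 1) := ⟨zero_lt_one⟩
  set x : Lp ℂ 2 (@AddCircle.haarAddCircle 1 _) := fourierBasis.repr.symm c with hx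
  have hxm := Lp.stronglyMeasurable x
  have hmp := AddCircle.measurePreserving_mk 1 (0 : ℝ)
  rw [zero_add] at hmp
  have hL : MemLp (fun t : ℝ => x (t : AddCircle (1 : ℝ))) 2
      (volume.restrict (Set.Ioc (0 : ℝ) 1)) := by
    have h1 : MemLp x 2 (volume : Measure (AddCircle (1 : ℝ))) := by
      rw [← memLp_haarAddCircle_iff]; exact Lp.memLp x
    exact h1.comp_measurePreserving hmp
  refine ⟨fun t => x (t : AddCircle (1 : ℝ)), L2per.of_memLp
    (hxm.measurable.comp AddCircle.measurable_mk') (fun t => ?_) hL, fun n => ?_⟩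
  · simp only [AddCircle.coe_add, AddCircle.coe_period, add_zero]
  · have h1 := fourierBasis_repr x n
    rw [hx, LinearIsometryEquiv.apply_symm_apply, ← hx,
      fourierCoeff_eq_intervalIntegral _ n 0] at h1
    rw [h1, fc]
    simp only [zero_add, div_one, one_smul]
    refine intervalIntegral.integral_congr fun t _ => ?_
    simp only [fourier_coe_apply, smul_eq_mul, chr]
    rw [mul_comm]
    congr 2
    push_cast; ring

/-! ### Riesz bases through coefficients, and Vandermonde systems. -/

/-- For the indicator `f` (of period one) of a set `S` of the circle: the exponentials with
frequencies in `Λ` form a Riesz basis of `L²(S)`, in the form that taking Fourier coefficients on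
`Λ` is a bijection from the square integrable functions supported on `S`. -/
def RieszPair (f : ℝ → ℤ) (Λ : Set ℤ) : Prop :=
  (∀ g, L2per g → (∀ t, f t = 0 → g t = 0) → (∀ n ∈ Λ, fc g n = 0) → ∀ᵐ t, g t = 0) ∧
  ∀ h, L2per h → ∃ g, L2per g ∧ (∀ t, f t = 0 → g t = 0) ∧ ∀ n ∈ Λ, fc g n = fc h n

/-- Test the relations against the polynomial whose roots are all the nodes but one; its degree is
below `n`, and it isolates the remaining unknown. -/
theorem eq_zero_of_sum_pow_mul_eq_zero {ι : Type*} (J : Finset ι) (ζ : ι → ℂ)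
    (hζ : Set.InjOn ζ J) {n : ℕ} (hn : J.card ≤ n) (x : ι → ℂ)
    (hx : ∀ i < n, ∑ j ∈ J, ζ j ^ i * x j = 0) : ∀ j ∈ J, x j = 0 := by
  classical
  intro j hj
  set p : Polynomial ℂ := ∏ k ∈ J.erase j, (Polynomial.X - Polynomial.C (ζ k)) with hp
  have hdeg : p.natDegree < n := by
    rw [hp, Polynomial.natDegree_prod_of_monic _ _ fun k _ => Polynomial.monic_X_sub_C _]
    simp only [Polynomial.natDegree_X_sub_C, Finset.sum_const, smul_eq_mul, mul_one]
    rw [Finset.card_erase_of_mem hj]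
    have := Finset.card_pos.2 ⟨j, hj⟩
    omega
  have h1 : ∑ k ∈ J, p.eval (ζ k) * x k = 0 := by
    have : ∀ k ∈ J, p.eval (ζ k) * x k =
        ∑ i ∈ Finset.range n, p.coeff i * (ζ k ^ i * x k) := by
      intro k _
      rw [Polynomial.eval_eq_sum_range' hdeg, Finset.sum_mul]
      exact Finset.sum_congr rfl fun i _ => by ring
    rw [Finset.sum_congr rfl this, Finset.sum_comm]
    refine Finset.sum_eq_zero fun i hi => ?_
    rw [← Finset.mul_sum, hx i (Finset.mem_range.1 hi), mul_zero]
  have hev : ∀ y, p.eval y = ∏ k ∈ J.erase j, (y - ζ k) := fun y => by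
    simp [hp, Polynomial.eval_prod]
  rw [Finset.sum_eq_single_of_mem j hj] at h1
  · refine (mul_eq_zero.1 h1).resolve_left ?_
    rw [hev, ← ne_eq, Finset.prod_ne_zero_iff]
    intro k hk h0
    rw [Finset.mem_erase] at hk
    exact hk.1 (hζ hk.2 hj (sub_eq_zero.1 h0).symm)
  · intro k hk hkj
    rw [hev, Finset.prod_eq_zero (Finset.mem_erase.2 ⟨hkj, hk⟩) (sub_self _), zero_mul]

/-- With exactly `n + 1` of the nodes the Vandermonde system is square and injective, hence
surjective; the other nodes get coefficient zero. -/
theorem exists_sum_pow_mul_eq {ι : Type*} (J : Finset ι) (ζ : ι → ℂ)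
    (hζ : Set.InjOn ζ J) {n : ℕ} (hn : n < J.card) :
    ∃ c : ι → ℂ, (∀ j ∉ J, c j = 0) ∧
      ∀ i ≤ n, ∑ j ∈ J, ζ j ^ i * c j = if i = n then 1 else 0 := by
  classical
  obtain ⟨K, hK, hcard⟩ := Finset.exists_subset_card_eq (s := J) (n := n + 1) hn
  let L : (K → ℂ) →ₗ[ℂ] (Fin (n + 1) → ℂ) :=
    { toFun := fun x i => ∑ j : K, ζ j ^ (i : ℕ) * x j
      map_add' := fun x y => by
        ext i; simp only [Pi.add_apply, mul_add, Finset.sum_add_distrib]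
      map_smul' := fun a x => by
        ext i
        simp only [Pi.smul_apply, smul_eq_mul, RingHom.id_apply, Finset.mul_sum]
        exact Finset.sum_congr rfl fun j _ => by ring }
  have hinj : Function.Injective L := by
    rw [← LinearMap.ker_eq_bot, LinearMap.ker_eq_bot']
    intro x hx
    ext j
    refine eq_zero_of_sum_pow_mul_eq_zero (Finset.univ : Finset K) (fun j => ζ j)
      (fun a _ b _ hab => Subtype.ext (hζ (hK a.2) (hK b.2) hab)) (n := n + 1)
      (by simp [hcard]) x (fun i hi => ?_) j (Finset.mem_univ _)
    exact congrFun hx ⟨i, hi⟩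
  have hsurj : Function.Surjective L := by
    rwa [← LinearMap.injective_iff_surjective_of_finrank_eq_finrank]
    simp [hcard]
  obtain ⟨x, hx⟩ := hsurj fun i => if (i : ℕ) = n then 1 else 0
  refine ⟨fun j => if h : j ∈ K then x ⟨j, h⟩ else 0, fun j hj => ?_, fun i hi => ?_⟩
  · exact dif_neg fun h => hj (hK h)
  · have h1 := congrFun hx ⟨i, Nat.lt_succ_of_le hi⟩
    simp only at h1
    rw [← h1, ← Finset.sum_subset hK]
    · rw [← Finset.sum_coe_sort K]
      refine Finset.sum_congr rfl fun j _ => ?_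
      simp
    · intro j _ hj
      simp only [dif_neg hj, mul_zero]

theorem injOn_chr_one_div (N : ℕ) :
    Set.InjOn (fun j : ℕ => chr 1 ((j : ℝ) / N)) (Finset.range N) := by
  intro a ha b hb hab
  simp only [Finset.coe_range, Set.mem_Iio] at ha hb
  have hN : (N : ℝ) ≠ 0 := by
    have : 0 < N := by omega
    positivity
  simp only [chr, Complex.exp_eq_exp_iff_exists_int] at hab
  obtain ⟨k, hk⟩ := hab
  have h2 : ((a : ℂ)) / N = b / N - k := by
    have h3 : (2 * Real.pi * Complex.I : ℂ) ≠ 0 := by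
      simp [Real.pi_ne_zero]
    have h4 : (2 * Real.pi * Complex.I : ℂ) * (a / N) =
        (2 * Real.pi * Complex.I : ℂ) * (b / N - k) := by
      push_cast at hk
      linear_combination -hk
    exact mul_left_cancel₀ h3 h4
  have h5 : (a : ℤ) = b - k * N := by
    have hNc : (N : ℂ) ≠ 0 := by exact_mod_cast hN
    field_simp at h2
    have : (a : ℂ) = b - N * k := h2
    rw [mul_comm] at this
    exact_mod_cast this
  have h6 : k = 0 := by
    by_contra hk0
    rcases lt_or_gt_of_ne hk0 with h | h <;> nlinarith
  rw [h6] at h5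
  omega

/-! ### Weighted sums over fibres. -/

/-- The sum of `g(s) e(-n s)` over the points `s` with `N s = t` modulo one. -/
noncomputable def fibreSum (N : ℕ) (n : ℤ) (g : ℝ → ℂ) (t : ℝ) : ℂ :=
  ∑ j ∈ Finset.range N, g ((t + j) / N) * chr n ((t + j) / N)

theorem sum_range_div_add_one {M : Type*} [AddCommGroup M] {h : ℝ → M}
    (hh : Function.Periodic h 1) {N : ℕ} (hN : 0 < N) (t : ℝ) :
    ∑ j ∈ Finset.range N, h ((t + 1 + j) / N) = ∑ j ∈ Finset.range N, h ((t + j) / N) := by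
  have h1 := Finset.sum_range_succ (fun j : ℕ => h ((t + j) / N)) N
  rw [Finset.sum_range_succ'] at h1
  have hN' : (N : ℝ) ≠ 0 := by positivity
  have h2 : h ((t + N) / N) = h ((t + (0 : ℕ)) / N) := by
    rw [← hh ((t + (0 : ℕ)) / N)]
    congr 1; field_simp; simp
  rw [h2] at h1
  have h3 := add_right_cancel h1
  rw [← h3]
  refine Finset.sum_congr rfl fun j _ => ?_
  push_cast
  congr 2; ring

theorem intervalIntegrable_comp_div_add {E : Type*} [NormedAddCommGroup E] {q : ℝ → E}
    (hq : ∀ a b, IntervalIntegrable q volume a b) {N : ℕ} (hN : 0 < N) (d a b : ℝ) :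
    IntervalIntegrable (fun t => q ((t + d) / N)) volume a b := by
  have hN' : (N : ℝ) ≠ 0 := by positivity
  have h1 := (hq ((a + d) / N) ((b + d) / N)).comp_mul_left (c := (N : ℝ)⁻¹)
  have h2 := h1.comp_add_right d
  convert h2 using 1
  · ext t; congr 1; field_simp
  · field_simp; ring
  · field_simp; ring

theorem L2per.fibreSum {g : ℝ → ℂ} (hg : L2per g) {N : ℕ} (hN : 0 < N) (n : ℤ) :
    L2per (fibreSum N n g) := by
  have hm : ∀ j : ℕ, Measurable fun t : ℝ => g ((t + j) / N) * chr n ((t + j) / N) := fun j =>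
    ((hg.mul_chr n).measurable.comp ((measurable_id.add_const _).div_const _))
  refine L2per.of_memLp (Finset.measurable_sum _ fun j _ => hm j) (fun t => ?_)
    (memLp_finsetSum _ fun j _ => ?_)
  · exact sum_range_div_add_one (hg.mul_chr n).periodic hN t
  · rw [memLp_two_iff_integrable_sq_norm (hm j).aestronglyMeasurable]
    have := intervalIntegrable_comp_div_add (hg.mul_chr n).intervalIntegrable_sq hN j 0 1
    exact (intervalIntegrable_iff_integrableOn_Ioc_of_le zero_le_one).1 this

/-- On the fibre, `e(-l t)` equals `e(-N l s)`, and the `N` pieces of the fibre integral tile the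
unit interval. The frequencies congruent to `n` modulo `N` are thus read off one fibre sum. -/
theorem fc_fibreSum {g : ℝ → ℂ} (hg : L2per g) {N : ℕ} (hN : 0 < N) (n l : ℤ) :
    fc (fibreSum N n g) l = N * fc g (N * l + n) := by
  have hN' : (N : ℝ) ≠ 0 := by positivity
  have h1 : ∀ t, fibreSum N n g t * chr l t = ∑ j ∈ Finset.range N,
      (fun s => g s * chr (N * l + n) s) ((t + j) / N) := by
    intro t
    rw [fibreSum, Finset.sum_mul]
    refine Finset.sum_congr rfl fun j _ => ?_
    have : chr l t = chr (N * l) ((t + j) / N) := by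
      rw [chr_mul_nat, mul_div_cancel₀ _ hN', ← chr_add_int l t j, Int.cast_natCast]
    simp only [this, chr_index_add]
    ring
  have hk := hg.mul_chr (N * l + n)
  rw [fc, fc]
  simp only [h1]
  have h3 := intervalIntegral.integral_finsetSum (s := Finset.range N)
    (f := fun (j : ℕ) t => (fun s => g s * chr (N * l + n) s) ((t + j) / N)) fun j _ =>
    intervalIntegrable_comp_div_add hk.intervalIntegrable hN j 0 1
  have h2 : ∀ j ∈ Finset.range N,
      ∫ t in (0 : ℝ)..1, (fun s => g s * chr (N * l + n) s) ((t + j) / N) =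
      N * ∫ s in ((j : ℕ) / N : ℝ)..((j + 1 : ℕ) / N : ℝ), g s * chr (N * l + n) s := by
    intro j _
    simp only [add_div]
    rw [intervalIntegral.integral_comp_div_add (fun s => g s * chr (N * l + n) s) hN']
    simp only [zero_div, zero_add, Complex.real_smul, Complex.ofReal_natCast]
    congr 3
    push_cast; ring
  rw [h3, Finset.sum_congr rfl h2, ← Finset.mul_sum,
    intervalIntegral.sum_integral_adjacent_intervals (a := fun j : ℕ => (j : ℝ) / N)
      fun j _ => hk.intervalIntegrable _ _]
  simp [div_self hN']

/-- The positions of the points of the fibre above `t` at which `f` is one. -/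
noncomputable def fibre (N : ℕ) (f : ℝ → ℤ) (t : ℝ) : Finset ℕ :=
  (Finset.range N).filter fun j => f ((t + j) / N) = 1

theorem fibre_subset (N : ℕ) (f : ℝ → ℤ) (t : ℝ) : fibre N f t ⊆ Finset.range N :=
  Finset.filter_subset _ _

theorem fold_eq_card {N : ℕ} {f : ℝ → ℤ} (h01 : ∀ t, f t = 0 ∨ f t = 1) (t : ℝ) :
    fold N f t = (fibre N f t).card := by
  rw [fibre, Finset.card_filter, fold]
  push_cast
  refine Finset.sum_congr rfl fun j _ => ?_
  rcases h01 ((t + j) / N) with h | h <;> simp [h]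

theorem level_fold_eq_zero_iff {N n : ℕ} {f : ℝ → ℤ} (h01 : ∀ t, f t = 0 ∨ f t = 1) (t : ℝ) :
    level n (fold N f) t = 0 ↔ (fibre N f t).card ≤ n := by
  rw [level, fold_eq_card h01]
  split_ifs with h
  · simp only [one_ne_zero, false_iff]; omega
  · simp only [true_iff]; omega

theorem chr_fibre (N : ℕ) (i j : ℕ) (t : ℝ) :
    chr i ((t + j) / N) = chr i (t / N) * chr 1 ((j : ℝ) / N) ^ i := by
  rw [add_div, chr_add, chr_natCast i ((j : ℝ) / N)]

/-- After the common unimodular factor `chr i (t / N)` is removed, the fibre sums form a Vandermonde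
system in the values of `g`, with distinct `N`-th roots of unity as nodes. -/
theorem eq_zero_of_fibreSum_eq_zero {N n : ℕ} {f : ℝ → ℤ} (h01 : ∀ t, f t = 0 ∨ f t = 1)
    {g : ℝ → ℂ} (hs : ∀ t, f t = 0 → g t = 0) {t : ℝ} (hn : (fibre N f t).card ≤ n)
    (h : ∀ i < n, fibreSum N i g t = 0) : ∀ j < N, g ((t + j) / N) = 0 := by
  have hout : ∀ j ∈ Finset.range N, j ∉ fibre N f t → g ((t + j) / N) = 0 := by
    intro j hj hj'
    refine hs _ ((h01 _).resolve_right fun h1 => hj' ?_)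
    exact Finset.mem_filter.2 ⟨hj, h1⟩
  have hin := eq_zero_of_sum_pow_mul_eq_zero (fibre N f t) (fun j : ℕ => chr 1 ((j : ℝ) / N))
    ((injOn_chr_one_div N).mono (Finset.coe_subset.2 (fibre_subset N f t))) hn
    (fun j => g ((t + j) / N)) (fun i hi => by
      have h1 := h i hi
      rw [fibreSum, ← Finset.sum_subset (fibre_subset N f t)] at h1
      · have h2 : chr i (t / N) * ∑ j ∈ fibre N f t,
            chr 1 ((j : ℝ) / N) ^ i * g ((t + j) / N) = 0 := by
          rw [← h1, Finset.mul_sum]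
          refine Finset.sum_congr rfl fun j _ => ?_
          rw [chr_fibre]; ring
        exact (mul_eq_zero.1 h2).resolve_left (chr_ne_zero _ _)
      · intro j hj hj'
        rw [hout j hj hj', zero_mul])
  intro j hj
  by_cases hj' : j ∈ fibre N f t
  · exact hin j hj'
  · exact hout j (Finset.mem_range.2 hj) hj'

theorem ae_of_ae_div {P : ℝ → Prop} {N : ℕ} (hN : 0 < N) (h : ∀ᵐ t : ℝ, P (t / N)) :
    ∀ᵐ t, P t := by
  have hN' : (N : ℝ) ≠ 0 := by positivity
  have hq : Measure.QuasiMeasurePreserving (fun t : ℝ => N * t) volume volume := by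
    refine ⟨measurable_const_mul _, ?_⟩
    rw [Real.map_volume_mul_left hN']
    exact Measure.smul_absolutelyContinuous
  filter_upwards [hq.ae h] with t ht
  rwa [mul_div_cancel_left₀ _ hN'] at ht

theorem fc_congr_ae {g h : ℝ → ℂ} (H : ∀ᵐ t, g t = h t) (n : ℤ) : fc g n = fc h n := by
  refine intervalIntegral.integral_congr_ae ?_
  filter_upwards [H] with t ht _
  rw [ht]

theorem periodic_fold {f : ℝ → ℤ} (hp : Function.Periodic f 1) {N : ℕ} (hN : 0 < N) :
    Function.Periodic (fold N f) 1 := fun t => sum_range_div_add_one hp hN t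

theorem measurable_fold {f : ℝ → ℤ} (hf : Measurable f) (N : ℕ) : Measurable (fold N f) :=
  Finset.measurable_sum _ fun _ _ => hf.comp ((measurable_id.add_const _).div_const _)

theorem measurable_level {F : ℝ → ℤ} (hF : Measurable F) (n : ℕ) : Measurable (level n F) :=
  Measurable.ite (hF (measurableSet_Ioi (a := (n : ℤ)))) measurable_const measurable_const

/-! ### Lifting Riesz bases from the superlevel sets of a folding. -/

section fold

variable {N : ℕ} {f : ℝ → ℤ} {Λ : ℕ → Set ℤ}

theorem ae_fibreSum_eq_zero (hN : 0 < N) (hm : Measurable f) (hp : Function.Periodic f 1)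
    (h01 : ∀ t, f t = 0 ∨ f t = 1) (H : ∀ n < N, RieszPair (level n (fold N f)) (Λ n))
    {g : ℝ → ℂ} (hg : L2per g) (hs : ∀ t, f t = 0 → g t = 0)
    (h0 : ∀ n < N, ∀ l ∈ Λ n, fc g (N * l + n) = 0) (n : ℕ) (hn : n < N) :
    ∀ᵐ t, fibreSum N n g t = 0 := by
  induction n using Nat.strong_induction_on with
  | _ n ih =>
    have hall : ∀ᵐ t, ∀ i, i < n → fibreSum N i g t = 0 := by
      refine ae_all_iff.2 fun i => ?_
      by_cases hi : i < n
      · filter_upwards [ih i hi (hi.trans hn)] with t ht _ using ht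
      · exact Eventually.of_forall fun t h => absurd h hi
    -- Off the superlevel set the fibre has at most `n` points, so the earlier vanishing sums
    -- already kill `g` there. Multiplying by the indicator turns this almost everywhere vanishing
    -- into the pointwise support condition of `RieszPair`.
    have heq : ∀ᵐ t, (level n (fold N f) t : ℂ) * fibreSum N n g t = fibreSum N n g t := by
      filter_upwards [hall] with t ht
      rcases level_mem n (fold N f) t with h | h
      · rw [h]
        have := eq_zero_of_fibreSum_eq_zero h01 hs ((level_fold_eq_zero_iff h01 t).1 h) ht
        have h2 : fibreSum N n g t = 0 := Finset.sum_eq_zero fun j hj => by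
          rw [this j (Finset.mem_range.1 hj), zero_mul]
        rw [h2, mul_zero]
      · rw [h]; simp
    have hL : L2per fun t => (level n (fold N f) t : ℂ) * fibreSum N n g t := by
      refine (hg.fibreSum hN n).bdd_mul ?_ (fun t => ?_) 1 (fun t => ?_)
      · exact (measurable_from_top (f := fun k : ℤ => (k : ℂ))).comp
          (measurable_level (measurable_fold hm N) n)
      · simp only [level, periodic_fold hp hN t]
      · rcases level_mem n (fold N f) t with h | h <;> simp [h]
    have := (H n hn).1 _ hL (fun t ht => by rw [ht]; simp) (fun l hl => by
      rw [fc_congr_ae heq, fc_fibreSum hg hN, h0 n hn l hl, mul_zero])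
    filter_upwards [heq, this] with t h1 h2
    rw [← h1, h2]

theorem ae_eq_zero_of_fold (hN : 0 < N) (hm : Measurable f) (hp : Function.Periodic f 1)
    (h01 : ∀ t, f t = 0 ∨ f t = 1) (H : ∀ n < N, RieszPair (level n (fold N f)) (Λ n))
    {g : ℝ → ℂ} (hg : L2per g) (hs : ∀ t, f t = 0 → g t = 0)
    (h0 : ∀ n < N, ∀ l ∈ Λ n, fc g (N * l + n) = 0) : ∀ᵐ t, g t = 0 := by
  have hall : ∀ᵐ t, ∀ i, i < N → fibreSum N i g t = 0 := by
    refine ae_all_iff.2 fun i => ?_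
    by_cases hi : i < N
    · filter_upwards [ae_fibreSum_eq_zero hN hm hp h01 H hg hs h0 i hi] with t ht _ using ht
    · exact Eventually.of_forall fun t h => absurd h hi
  refine ae_of_ae_div hN ?_
  filter_upwards [hall] with t ht
  have hc : (fibre N f t).card ≤ N := by
    simpa using Finset.card_le_card (fibre_subset N f t)
  simpa using eq_zero_of_fibreSum_eq_zero h01 hs hc ht 0 hN

theorem measurable_fibre_apply (hm : Measurable f) (c : Finset ℕ → ℕ → ℂ) {k : ℝ → ℕ} {τ : ℝ → ℝ}
    (hk : Measurable k) (hτ : Measurable τ) : Measurable fun s => c (fibre N f (τ s)) (k s) := by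
  let _ : MeasurableSpace (Finset ℕ) := ⊤
  have : DiscreteMeasurableSpace (Finset ℕ) := ⟨fun _ => trivial⟩
  have hF : Measurable (fibre N f) := by
    refine measurable_to_countable' fun A => ?_
    have : fibre N f ⁻¹' {A} = {t | ∀ j : ℕ, (j ∈ Finset.range N ∧ f ((t + j) / N) = 1) ↔ j ∈ A} := by
      ext t
      simp [fibre, Finset.ext_iff]
    rw [this]
    have hset : ∀ j : ℕ, MeasurableSet {t : ℝ | f ((t + j) / N) = 1} := fun j =>
      (hm.comp ((measurable_id.add_const (j : ℝ)).div_const (N : ℝ))) (measurableSet_singleton 1)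
    rw [Set.ofPred_forall]
    refine MeasurableSet.iInter fun j => ?_
    by_cases h1 : j ∈ Finset.range N <;> by_cases h2 : j ∈ A
    · simpa [h1, h2] using hset j
    · simp only [h1, h2, true_and, iff_false]
      exact (hset j).compl
    · simp [h1, h2]
    · simp [h1, h2]
  have h2 : Measurable fun p : Finset ℕ × ℕ => c p.1 p.2 := measurable_of_countable _
  exact h2.comp ((hF.comp hτ).prodMk hk)

theorem L2per.comp_nat_mul {U : ℝ → ℂ} (hU : L2per U) (hN : 0 < N) :
    L2per fun s => U (N * s) := by
  have hN' : (N : ℝ) ≠ 0 := by positivity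
  refine ⟨hU.measurable.comp (measurable_const_mul _), fun s => ?_, ?_⟩
  · have := hU.periodic.nat_mul N (N * s)
    rw [mul_one] at this
    rw [mul_add, mul_one, this]
  · have := (hU.intervalIntegrable_sq 0 N).comp_mul_left (c := (N : ℝ))
    simpa [div_self hN'] using this

/-- A function supported on `f = 1` with prescribed `n`-th fibre sum and vanishing earlier ones. -/
theorem exists_fibreSum_eq (hN : 0 < N) (hm : Measurable f) (hp : Function.Periodic f 1)
    (h01 : ∀ t, f t = 0 ∨ f t = 1) (n : ℕ) {U : ℝ → ℂ} (hU : L2per U)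
    (hs : ∀ t, level n (fold N f) t = 0 → U t = 0) :
    ∃ u, L2per u ∧ (∀ t, f t = 0 → u t = 0) ∧
      ∀ i ≤ n, ∀ t ∈ Set.Ico (0 : ℝ) 1, fibreSum N i u t = if i = n then U t else 0 := by
  have hN' : (N : ℝ) ≠ 0 := by positivity
  have hNp : (0 : ℝ) < N := by positivity
  -- These are the dual Vandermonde weights for each possible fibre; the zero vector is a default
  -- when the fibre is too small, where `U` vanishes anyway.
  have hc : ∀ J : Finset ℕ, ∃ c : ℕ → ℂ, (∀ j ∉ J, c j = 0) ∧
      (J ⊆ Finset.range N → n < J.card →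
        ∀ i ≤ n, ∑ j ∈ J, chr 1 ((j : ℝ) / N) ^ i * c j = if i = n then 1 else 0) := by
    intro J
    by_cases h : J ⊆ Finset.range N ∧ n < J.card
    · obtain ⟨c, h1, h2⟩ := exists_sum_pow_mul_eq J (fun j : ℕ => chr 1 ((j : ℝ) / N))
        ((injOn_chr_one_div N).mono (Finset.coe_subset.2 h.1)) h.2
      exact ⟨c, h1, fun _ _ => h2⟩
    · exact ⟨0, fun _ _ => rfl, fun h1 h2 => absurd ⟨h1, h2⟩ h⟩
  choose c hc0 hc1 using hc
  have hidx : ∀ s : ℝ, ⌊N * Int.fract s⌋₊ < N := by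
    intro s
    rw [Nat.floor_lt (by have := Int.fract_nonneg s; positivity)]
    have := Int.fract_lt_one s
    nlinarith
  have hfr : ∀ s : ℝ, (Int.fract (N * s) + ⌊N * Int.fract s⌋₊) / N = Int.fract s := by
    intro s
    have h1 : Int.fract ((N : ℝ) * s) = Int.fract (N * Int.fract s) := by
      have : (N : ℝ) * s = N * Int.fract s + ((N * ⌊s⌋ : ℤ) : ℝ) := by
        push_cast
        rw [← mul_add, Int.fract_add_floor]
      rw [this, Int.fract_add_intCast]
    have h2 : ((⌊N * Int.fract s⌋₊ : ℕ) : ℝ) = ⌊N * Int.fract s⌋ := by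
      rw [← Int.natCast_floor_eq_floor (by have := Int.fract_nonneg s; positivity)]
      simp
    rw [h1, h2, Int.fract_add_floor, mul_div_cancel_left₀ _ hN']
  -- Modulo one, `s = (t + j) / N` with `t = Int.fract (N * s)` and `j = ⌊N * Int.fract s⌋₊`. The
  -- character `chr (-n)` cancels the phase `chr n (t / N)` common to the fibre.
  set φ : ℝ → ℂ := fun s => c (fibre N f (Int.fract (N * s))) ⌊N * Int.fract s⌋₊ *
    chr (-n) (Int.fract (N * s) / N) with hφ
  have hφm : Measurable φ := by
    refine (measurable_fibre_apply hm c ?_ ?_).mul ((measurable_chr _).comp ?_)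
    · exact Nat.measurable_floor.comp (measurable_fract.const_mul _)
    · exact measurable_fract.comp (measurable_const_mul _)
    · exact (measurable_fract.comp (measurable_const_mul _)).div_const _
  have hφp : Function.Periodic φ 1 := by
    intro s
    have : Int.fract ((N : ℝ) * (s + 1)) = Int.fract (N * s) := by
      rw [mul_add, mul_one, Int.fract_add_natCast]
    simp only [hφ, this, Int.fract_add_one]
  -- Only finitely many fibres occur, so the weights are uniformly bounded.
  have hφb : ∀ s, ‖φ s‖ ≤ ∑ J ∈ (Finset.range N).powerset, ∑ j ∈ Finset.range N, ‖c J j‖ := by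
    intro s
    rw [hφ]
    simp only [norm_mul, norm_chr, mul_one]
    refine le_trans ?_ (Finset.single_le_sum (f := fun J => ∑ j ∈ Finset.range N, ‖c J j‖)
      (fun J _ => Finset.sum_nonneg fun j _ => norm_nonneg _)
      (Finset.mem_powerset.2 (fibre_subset N f (Int.fract (N * s)))))
    exact Finset.single_le_sum (f := fun j => ‖c _ j‖) (fun j _ => norm_nonneg _)
      (Finset.mem_range.2 (hidx s))
  refine ⟨fun s => φ s * U (N * s), (hU.comp_nat_mul hN).bdd_mul hφm hφp _ hφb, ?_, ?_⟩
  · intro s hfs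
    have h1 : ⌊N * Int.fract s⌋₊ ∉ fibre N f (Int.fract (N * s)) := by
      intro h
      have h2 := (Finset.mem_filter.1 h).2
      rw [hfr] at h2
      have h3 : f (Int.fract s) = f s := by
        have := hp.sub_int_mul_eq ⌊s⌋ (x := s)
        rwa [mul_one, Int.self_sub_floor] at this
      omega
    simp only [hφ, hc0 _ _ h1, zero_mul]
  · intro i hi t ht
    have hval : ∀ j ∈ Finset.range N, φ ((t + j) / N) * U (N * ((t + j) / N)) =
        c (fibre N f t) j * chr (-n) (t / N) * U t := by
      intro j hj
      have hj' : (j : ℝ) + 1 ≤ N := by exact_mod_cast Finset.mem_range.1 hj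
      have h1 : (N : ℝ) * ((t + j) / N) = t + j := mul_div_cancel₀ _ hN'
      have h2 : Int.fract ((t + j) / N) = (t + j) / N := by
        rw [Int.fract_eq_self]
        constructor
        · have := ht.1; positivity
        · rw [div_lt_one hNp]; linarith [ht.2]
      have h3 : ⌊t + (j : ℝ)⌋₊ = j := by
        rw [Nat.floor_eq_iff (by linarith [ht.1, (Nat.cast_nonneg j : (0 : ℝ) ≤ j)])]
        constructor <;> linarith [ht.1, ht.2]
      have h4 : Int.fract (t + (j : ℝ)) = t := by
        rw [Int.fract_add_natCast, Int.fract_eq_self.2 ht]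
      have h5 : U (t + j) = U t := by simpa using hU.periodic.nat_mul j t
      simp only [hφ]
      rw [h2, h1, h3, h4, h5]
    rw [fibreSum]
    have h6 : ∀ j ∈ Finset.range N, φ ((t + j) / N) * U (N * ((t + j) / N)) * chr i ((t + j) / N) =
        chr i (t / N) * chr (-n) (t / N) * U t *
          (chr 1 ((j : ℝ) / N) ^ i * c (fibre N f t) j) := by
      intro j hj
      rw [hval j hj, chr_fibre]; ring
    rw [Finset.sum_congr rfl h6, ← Finset.mul_sum,
      ← Finset.sum_subset (fibre_subset N f t)
        (fun j _ hj => by rw [hc0 _ _ hj, mul_zero])]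
    by_cases hcard : (fibre N f t).card ≤ n
    · rw [hs t ((level_fold_eq_zero_iff h01 t).2 hcard)]
      simp
    · rw [hc1 _ (fibre_subset N f t) (not_le.1 hcard) i hi]
      split_ifs with h
      · subst h
        rw [← chr_index_add, add_neg_cancel]
        simp [chr]
      · rw [mul_zero]

theorem fc_congr_Ico {g h : ℝ → ℂ} (H : ∀ t ∈ Set.Ico (0 : ℝ) 1, g t = h t) (n : ℤ) :
    fc g n = fc h n :=
  intervalIntegral.integral_congr_Ioo_of_le zero_le_one fun t ht => by
    rw [H t ⟨ht.1.le, ht.2⟩]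

/-- The residue classes are corrected one at a time. The correction for class `n` has vanishing
fibre sums of smaller index, so it does not disturb the classes already matched; later ones are
repaired afterwards. -/
theorem exists_fc_eq_of_fold (hN : 0 < N) (hm : Measurable f) (hp : Function.Periodic f 1)
    (h01 : ∀ t, f t = 0 ∨ f t = 1) (H : ∀ n < N, RieszPair (level n (fold N f)) (Λ n))
    {h : ℝ → ℂ} (hh : L2per h) (n : ℕ) (hn : n ≤ N) :
    ∃ g, L2per g ∧ (∀ t, f t = 0 → g t = 0) ∧
      ∀ i < n, ∀ l ∈ Λ i, fc g (N * l + i) = fc h (N * l + i) := by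
  have hNc : (N : ℂ) ≠ 0 := by exact_mod_cast hN.ne'
  induction n with
  | zero => exact ⟨fun _ => 0, L2per.zero, fun _ _ => rfl, fun i hi => absurd hi (by omega)⟩
  | succ n ih =>
    obtain ⟨g, hg, hgs, hgf⟩ := ih (by omega)
    obtain ⟨U, hU, hUs, hUf⟩ := (H n (by omega)).2 _ ((hh.sub hg).fibreSum hN n)
    obtain ⟨u, hu, hus, hui⟩ := exists_fibreSum_eq hN hm hp h01 n hU hUs
    refine ⟨fun t => g t + u t, hg.add hu, fun t ht => by simp only [hgs t ht, hus t ht, add_zero],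
      fun i hi l hl => ?_⟩
    rw [L2per.fc_add hg hu]
    have h1 := fc_fibreSum hu hN i l
    rw [fc_congr_Ico (hui i (by omega)) l] at h1
    split_ifs at h1 with hin
    · subst hin
      have h2 := hUf l hl
      rw [fc_fibreSum (hh.sub hg) hN, L2per.fc_sub hh hg] at h2
      have h3 := mul_left_cancel₀ hNc (h1.symm.trans h2)
      rw [h3]; ring
    · have h2 : fc u (N * l + i) = 0 := by
        have : (0 : ℂ) = N * fc u (N * l + i) := by rw [← h1]; simp [fc]
        exact (mul_eq_zero.1 this.symm).resolve_left hNc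
      rw [h2, add_zero, hgf i (by omega) l hl]

/-- Combining Riesz bases of the superlevel sets of the folding of `f` into one for `f`. -/
theorem rieszPair_of_fold (hN : 0 < N) (hm : Measurable f) (hp : Function.Periodic f 1)
    (h01 : ∀ t, f t = 0 ∨ f t = 1) (H : ∀ n < N, RieszPair (level n (fold N f)) (Λ n)) :
    RieszPair f {m | m / (N : ℤ) ∈ Λ (m % (N : ℤ)).toNat} := by
  have hNz : (N : ℤ) ≠ 0 := by omega
  refine ⟨fun g hg hs h0 => ae_eq_zero_of_fold hN hm hp h01 H hg hs fun n hn l hl => h0 _ ?_,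
    fun h hh => ?_⟩
  · have h1 : ((N : ℤ) * l + n) % N = n := by
      rw [Int.mul_add_emod_self_left, Int.emod_eq_of_lt (by omega) (by omega)]
    have h2 : ((N : ℤ) * l + n) / N = l := by
      rw [Int.mul_add_ediv_left _ _ hNz, Int.ediv_eq_zero_of_lt (by omega) (by omega), add_zero]
    simp only [Set.mem_ofPred_eq, h1, h2, Int.toNat_natCast]
    exact hl
  · obtain ⟨g, hg, hgs, hgf⟩ := exists_fc_eq_of_fold hN hm hp h01 H hh N le_rfl
    refine ⟨g, hg, hgs, fun m hm' => ?_⟩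
    have h1 := Int.emod_nonneg m hNz
    have h2 := Int.emod_lt_of_pos m (show (0 : ℤ) < N by omega)
    have := hgf (m % (N : ℤ)).toNat (by omega) _ hm'
    rwa [Int.toNat_of_nonneg h1, Int.mul_ediv_add_emod] at this

end fold

/-! ### Perturbed exponentials on the unit interval. -/

section Perturbation

local notation "μ₁" => (volume.restrict (Set.Ioc (0 : ℝ) 1) : Measure ℝ)
local notation "H₁" => Lp ℂ 2 (volume.restrict (Set.Ioc (0 : ℝ) 1))
local notation "ℓ₂" => lp (fun _ : ℤ => ℂ) 2

theorem norm_sq_eq_integral (x : H₁) : ‖x‖ ^ 2 = ∫ t in (0 : ℝ)..1, ‖x t‖ ^ 2 := by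
  have H₃ := congr_arg RCLike.re (@L2.inner_def ℝ ℂ ℂ _ _ _ _ _ x x)
  rw [← integral_re (L2.integrable_inner x x)] at H₃
  simp only [← norm_sq_eq_re_inner] at H₃
  rw [H₃, intervalIntegral.integral_of_le zero_le_one]

theorem memLp_integrable_mul_chr {g : ℝ → ℂ} (hg : MemLp g 2 μ₁) (n : ℤ) :
    IntervalIntegrable (fun t => g t * chr n t) volume 0 1 := by
  rw [intervalIntegrable_iff_integrableOn_Ioc_of_le zero_le_one]
  refine (hg.integrable one_le_two).mul_bdd (c := 1)
    (continuous_chr n).aestronglyMeasurable ?_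
  exact Eventually.of_forall fun t => (norm_chr n t).le

theorem fc_congr_ae_restrict {g h : ℝ → ℂ} (H : g =ᵐ[μ₁] h) (n : ℤ) : fc g n = fc h n := by
  unfold fc
  rw [intervalIntegral.integral_of_le zero_le_one, intervalIntegral.integral_of_le zero_le_one]
  exact integral_congr_ae (H.mono fun t ht => by simp only [ht])

theorem memℓp_two_of_summable {ι : Type*} {c : ι → ℂ} (h : Summable fun n => ‖c n‖ ^ 2) :
    Memℓp c 2 := memℓp_gen (by simpa using h)

/-- Fourier coefficients as an isometry onto the square summable sequences. -/
noncomputable def fourierIsometry : H₁ →ₗᵢ[ℂ] ℓ₂ where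
  toFun x := ⟨fc x, memℓp_two_of_summable (hasSum_sq_fc_of_memLp (Lp.memLp x)).summable⟩
  map_add' x y := by
    ext n
    change fc _ n = fc _ n + fc _ n
    rw [fc_congr_ae_restrict (Lp.coeFn_add x y)]
    unfold fc
    rw [← intervalIntegral.integral_add (memLp_integrable_mul_chr (Lp.memLp x) n)
      (memLp_integrable_mul_chr (Lp.memLp y) n)]
    simp only [Pi.add_apply, add_mul]
  map_smul' a x := by
    ext n
    change fc _ n = a * fc _ n
    rw [fc_congr_ae_restrict (Lp.coeFn_smul a x)]
    unfold fc
    rw [← intervalIntegral.integral_const_mul]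
    simp only [Pi.smul_apply, smul_eq_mul, mul_assoc]
  norm_map' x := by
    have h1 := lp.hasSum_norm (p := 2) (by simp)
      (⟨fc x, memℓp_two_of_summable (hasSum_sq_fc_of_memLp (Lp.memLp x)).summable⟩ : ℓ₂)
    simp only [ENNReal.toReal_ofNat, Real.rpow_ofNat] at h1
    have h2 := (h1.unique (hasSum_sq_fc_of_memLp (Lp.memLp x))).trans (norm_sq_eq_integral x).symm
    exact (sq_eq_sq₀ (norm_nonneg _) (norm_nonneg _)).1 h2

theorem fourierIsometry_apply (x : H₁) (n : ℤ) : fourierIsometry x n = fc x n := rfl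

theorem fourierIsometry_surjective : Function.Surjective fourierIsometry := by
  intro c
  obtain ⟨g, hg, hgc⟩ := exists_L2per_fc_eq c
  refine ⟨hg.memLp.toLp g, ?_⟩
  ext n
  rw [fourierIsometry_apply, fc_congr_ae_restrict hg.memLp.coeFn_toLp, hgc]

theorem memLp_pow_mul (k : ℕ) (x : H₁) : MemLp (fun t : ℝ => (t : ℂ) ^ k * x t) 2 μ₁ := by
  refine (Lp.memLp x).of_le ?_ ?_
  · exact (by fun_prop : Measurable fun t : ℝ => (t : ℂ) ^ k).aestronglyMeasurable.mul
      (Lp.aestronglyMeasurable x)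
  · rw [ae_restrict_iff' measurableSet_Ioc]
    refine Eventually.of_forall fun t ht => ?_
    rw [norm_mul, norm_pow, Complex.norm_real, Real.norm_of_nonneg ht.1.le]
    exact mul_le_of_le_one_left (norm_nonneg _) (pow_le_one₀ ht.1.le ht.2)

/-- Multiplication by `t ^ k` on `L²(0, 1)`. -/
noncomputable def mulPow (k : ℕ) : H₁ →L[ℂ] H₁ :=
  LinearMap.mkContinuous
    { toFun x := (memLp_pow_mul k x).toLp _
      map_add' x y := by
        rw [← MemLp.toLp_add]
        refine MemLp.toLp_congr _ _ ?_
        filter_upwards [Lp.coeFn_add x y] with t ht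
        simp only [ht, Pi.add_apply, mul_add]
      map_smul' a x := by
        rw [RingHom.id_apply, ← MemLp.toLp_const_smul]
        refine MemLp.toLp_congr _ _ ?_
        filter_upwards [Lp.coeFn_smul a x] with t ht
        simp only [ht, Pi.smul_apply, smul_eq_mul]
        ring } 1 fun x => by
    rw [one_mul]
    refine Lp.norm_le_norm_of_ae_le ?_
    filter_upwards [(memLp_pow_mul k x).coeFn_toLp, ae_restrict_mem measurableSet_Ioc] with t h ht
    simp only [LinearMap.coe_mk, AddHom.coe_mk]
    rw [h, norm_mul, norm_pow, Complex.norm_real, Real.norm_of_nonneg ht.1.le]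
    exact mul_le_of_le_one_left (norm_nonneg _) (pow_le_one₀ ht.1.le ht.2)

theorem norm_mulPow_le (k : ℕ) : ‖mulPow k‖ ≤ 1 := LinearMap.mkContinuous_norm_le _ zero_le_one _

theorem coeFn_mulPow (k : ℕ) (x : H₁) : mulPow k x =ᵐ[μ₁] fun t : ℝ => (t : ℂ) ^ k * x t :=
  MemLp.coeFn_toLp (memLp_pow_mul k x)

variable (d : ℤ → ℂ) (hd : ∀ n, ‖d n‖ ≤ 2 / 5)
include hd

theorem norm_smul_id_le (k : ℕ) (n : ℤ) :
    ‖(d n ^ k / k.factorial) • ContinuousLinearMap.id ℂ ℂ‖ ≤ (2 / 5 : ℝ) ^ k := by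
  refine (norm_smul_le (d n ^ k / k.factorial) (ContinuousLinearMap.id ℂ ℂ)).trans ?_
  have h1 := ContinuousLinearMap.norm_id_le (𝕜 := ℂ) (E := ℂ)
  rw [norm_div, norm_pow, Complex.norm_natCast]
  have h2 : ‖d n‖ ^ k / k.factorial ≤ (2 / 5 : ℝ) ^ k := by
    refine (div_le_self (by positivity) ?_).trans
      (pow_le_pow_left₀ (norm_nonneg _) (hd n) k)
    exact_mod_cast k.factorial_pos
  calc _ ≤ (2 / 5 : ℝ) ^ k * 1 := by gcongr
    _ = _ := mul_one _

/-- The `k`-th term of the expansion of the coefficients `∫ x(t) exp(d_n t) e(-n t) dt`. -/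
noncomputable def pertTerm (k : ℕ) : H₁ →L[ℂ] ℓ₂ :=
  (lp.mapCLM 2 (fun n : ℤ => (d n ^ k / k.factorial) • ContinuousLinearMap.id ℂ ℂ)
    (by positivity) (norm_smul_id_le d hd k)) ∘L
  (fourierIsometry.toContinuousLinearMap ∘L mulPow k)

theorem norm_pertTerm_le (k : ℕ) : ‖pertTerm d hd k‖ ≤ (2 / 5 : ℝ) ^ k := by
  refine (ContinuousLinearMap.opNorm_comp_le _ _).trans ?_
  have h1 := lp.norm_mapCLM_le 2
    (fun n : ℤ => (d n ^ k / k.factorial) • ContinuousLinearMap.id ℂ ℂ)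
    (by positivity) (norm_smul_id_le d hd k)
  have h2 := ContinuousLinearMap.opNorm_comp_le fourierIsometry.toContinuousLinearMap (mulPow k)
  have h3 := fourierIsometry.norm_toContinuousLinearMap_le
  have h4 := norm_mulPow_le k
  have h5 : ‖fourierIsometry.toContinuousLinearMap ∘L mulPow k‖ ≤ 1 := by
    refine h2.trans ?_
    calc _ ≤ (1 : ℝ) * 1 := by gcongr
      _ = 1 := one_mul 1
  calc _ ≤ (2 / 5 : ℝ) ^ k * 1 := by gcongr
    _ = _ := mul_one _

theorem pertTerm_apply (k : ℕ) (x : H₁) (n : ℤ) :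
    pertTerm d hd k x n = d n ^ k / k.factorial * fc (fun t : ℝ => (t : ℂ) ^ k * x t) n := by
  rw [← fc_congr_ae_restrict (coeFn_mulPow k x)]
  rfl

theorem summable_pertTerm : Summable (pertTerm d hd) :=
  Summable.of_norm_bounded (summable_geometric_of_lt_one (by norm_num) (by norm_num))
    (norm_pertTerm_le d hd)

theorem pertTerm_zero : pertTerm d hd 0 = fourierIsometry.toContinuousLinearMap := by
  ext x n
  rw [pertTerm_apply]
  simp [fourierIsometry_apply]

/-- The operator taking `x` to the coefficients `∫ x(t) exp(d_n t) e(-n t) dt`. -/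
noncomputable def pertOp : H₁ →L[ℂ] ℓ₂ := ∑' k, pertTerm d hd k

/-- The exponential series in `d n * t` is integrated termwise, dominated by a geometric series
times `‖x t‖`. -/
theorem pertOp_apply (x : H₁) (n : ℤ) :
    pertOp d hd x n =
      ∫ t in (0 : ℝ)..1, x t * (Complex.exp (d n * t) * chr n t) := by
  have h1 := ((lp.evalCLM ℂ (fun _ : ℤ => ℂ) 2 n).hasSum
    ((summable_pertTerm d hd).hasSum.mapL (ContinuousLinearMap.apply ℂ ℓ₂ x)))
  have hx : IntervalIntegrable x volume 0 1 := by
    rw [intervalIntegrable_iff_integrableOn_Ioc_of_le zero_le_one]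
    exact (Lp.memLp x).integrable one_le_two
  have h2 : HasSum (fun k : ℕ => ∫ t in (0 : ℝ)..1,
      x t * ((d n * t) ^ k / k.factorial * chr n t))
      (∫ t in (0 : ℝ)..1, x t * (Complex.exp (d n * t) * chr n t)) := by
    refine intervalIntegral.hasSum_integral_of_dominated_convergence
      (fun k t => ‖x t‖ * (2 / 5 : ℝ) ^ k) (fun k => ?_) (fun k => ?_) ?_ ?_ ?_
    · rw [Set.uIoc_of_le zero_le_one]
      refine (Lp.aestronglyMeasurable x).mul
        (Continuous.aestronglyMeasurable ?_)
      have := continuous_chr n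
      fun_prop
    · refine Eventually.of_forall fun t ht => ?_
      rw [Set.uIoc_of_le zero_le_one] at ht
      rw [norm_mul, norm_mul, norm_chr, mul_one, norm_div, norm_pow, norm_mul,
        Complex.norm_real, Real.norm_of_nonneg ht.1.le, Complex.norm_natCast]
      refine mul_le_mul_of_nonneg_left ?_ (norm_nonneg _)
      have h3 : ‖d n‖ * t ≤ 2 / 5 := by
        calc _ ≤ ‖d n‖ * 1 := by gcongr; exact ht.2
          _ ≤ _ := by rw [mul_one]; exact hd n
      refine (div_le_self (by have := ht.1.le; positivity) ?_).trans
        (pow_le_pow_left₀ (by have := ht.1.le; positivity) h3 k)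
      exact_mod_cast k.factorial_pos
    · exact Eventually.of_forall fun t _ =>
        (summable_geometric_of_lt_one (by norm_num) (by norm_num)).mul_left _
    · simp only [tsum_mul_left]
      exact hx.norm.mul_const _
    · refine Eventually.of_forall fun t _ => HasSum.mul_left _ (HasSum.mul_right _ ?_)
      have := NormedSpace.expSeries_div_hasSum_exp (d n * (t : ℂ))
      rwa [← Complex.exp_eq_exp_ℂ] at this
  have h3 : ∀ k : ℕ, ∫ t in (0 : ℝ)..1, x t * ((d n * t) ^ k / k.factorial * chr n t) =
      pertTerm d hd k x n := by
    intro k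
    rw [pertTerm_apply, fc, ← intervalIntegral.integral_const_mul]
    congr 1
    ext t
    ring
  simp only [h3] at h2
  exact h1.unique h2

/-- The term `k = 0` is the Fourier isometry onto `ℓ²`; the others have total norm at most `∑_{k ≥
1} (2/5)^k = 2/3 < 1`, so a Neumann series inverts the operator. -/
theorem bijective_pertOp : Function.Bijective (pertOp d hd) := by
  set T := pertOp d hd with hT
  let e : H₁ ≃ₗᵢ[ℂ] ℓ₂ := LinearIsometryEquiv.ofSurjective fourierIsometry
    fourierIsometry_surjective
  have h1 : ‖fourierIsometry.toContinuousLinearMap - T‖ ≤ 2 / 3 := by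
    rw [hT, pertOp, (summable_pertTerm d hd).tsum_eq_zero_add, pertTerm_zero, sub_add_cancel_left,
      norm_neg]
    refine tsum_of_norm_bounded ?_ (fun k => norm_pertTerm_le d hd (k + 1))
    have := (hasSum_geometric_of_lt_one (r := (2 / 5 : ℝ)) (by norm_num) (by norm_num)).mul_left
      (2 / 5 : ℝ)
    simp only [← pow_succ'] at this
    rwa [show (2 / 5 : ℝ) * (1 - 2 / 5)⁻¹ = 2 / 3 by norm_num] at this
  set A : H₁ →L[ℂ] H₁ := (e.symm.toContinuousLinearEquiv : ℓ₂ →L[ℂ] H₁) ∘L T with hA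
  have h2 : ‖1 - A‖ < 1 := by
    refine lt_of_le_of_lt (ContinuousLinearMap.opNorm_le_bound _ (by norm_num : (0 : ℝ) ≤ 2 / 3)
      fun x => ?_) (by norm_num)
    have h3 : (1 - A) x = e.symm (fourierIsometry x - T x) := by
      rw [map_sub]
      have : e.symm (fourierIsometry x) = x := e.symm_apply_apply x
      rw [this]
      rfl
    rw [h3, LinearIsometryEquiv.norm_map]
    exact (fourierIsometry.toContinuousLinearMap - T).le_of_opNorm_le h1 x
  have h4 : IsUnit A := by
    have := (Units.oneSub (1 - A) h2).isUnit
    rwa [Units.val_oneSub, sub_sub_cancel] at this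
  have h5 : Function.Bijective A := by
    obtain ⟨u, hu⟩ := h4
    have := (ContinuousLinearEquiv.unitsEquiv ℂ H₁ u).bijective
    rw [← hu]
    exact this
  have h6 : (T : H₁ → ℓ₂) = e ∘ A := by
    ext1 x
    exact (e.apply_symm_apply (T x)).symm
  rw [h6]
  exact e.bijective.comp h5

omit hd

/-- The bound `π < 4` suffices: `2 * 4 / 20 = 2 / 5`. -/
theorem norm_two_pi_mul_le {ε : ℝ} (hε : |ε| ≤ 1 / 20) :
    ‖(-(2 * Real.pi * Complex.I * ε) : ℂ)‖ ≤ 2 / 5 := by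
  have hpi := Real.pi_lt_four
  have hpi0 := Real.pi_pos
  simp only [norm_neg, norm_mul, Complex.norm_ofNat, Complex.norm_real, Complex.norm_I, mul_one,
    Real.norm_eq_abs, abs_of_pos hpi0]
  nlinarith [abs_nonneg ε]

theorem exp_mul_chr (n : ℤ) (ε t : ℝ) :
    Complex.exp (-(2 * Real.pi * Complex.I * ε) * t) * chr n t =
      Complex.exp (-(2 * Real.pi * Complex.I * (n + ε) * t)) := by
  rw [chr, ← Complex.exp_add]
  congr 1; ring

/-- Small perturbations of the integers are frequencies of a Riesz basis of `L²(0, 1)`: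
uniqueness. -/
theorem ae_eq_zero_of_perturbed (ε : ℤ → ℝ) (hε : ∀ n, |ε n| ≤ 1 / 20) {g : ℝ → ℂ}
    (hg : MemLp g 2 μ₁)
    (h : ∀ n, ∫ t in (0 : ℝ)..1, g t *
      Complex.exp (-(2 * Real.pi * Complex.I * (n + ε n) * t)) = 0) : g =ᵐ[μ₁] 0 := by
  set d : ℤ → ℂ := fun n => -(2 * Real.pi * Complex.I * ε n)
  have hd : ∀ n, ‖d n‖ ≤ 2 / 5 := fun n => norm_two_pi_mul_le (hε n)
  have h0 : pertOp d hd (hg.toLp g) = 0 := by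
    ext n
    rw [pertOp_apply, lp.coeFn_zero, Pi.zero_apply, ← h n,
      intervalIntegral.integral_of_le zero_le_one, intervalIntegral.integral_of_le zero_le_one]
    refine integral_congr_ae ?_
    filter_upwards [hg.coeFn_toLp] with t ht
    rw [ht, exp_mul_chr]
  have h1 : hg.toLp g = 0 := (bijective_pertOp d hd).1 (h0.trans (map_zero _).symm)
  exact hg.coeFn_toLp.symm.trans ((Lp.eq_zero_iff_ae_eq_zero).1 h1)

/-- Small perturbations of the integers are frequencies of a Riesz basis of `L²(0, 1)`:
existence. -/
theorem exists_of_perturbed (ε : ℤ → ℝ) (hε : ∀ n, |ε n| ≤ 1 / 20) {c : ℤ → ℂ}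
    (hc : Summable fun n => ‖c n‖ ^ 2) :
    ∃ g, Measurable g ∧ MemLp g 2 μ₁ ∧ ∀ n, ∫ t in (0 : ℝ)..1, g t *
      Complex.exp (-(2 * Real.pi * Complex.I * (n + ε n) * t)) = c n := by
  set d : ℤ → ℂ := fun n => -(2 * Real.pi * Complex.I * ε n)
  have hd : ∀ n, ‖d n‖ ≤ 2 / 5 := fun n => norm_two_pi_mul_le (hε n)
  obtain ⟨x, hx⟩ := (bijective_pertOp d hd).2 ⟨c, memℓp_two_of_summable hc⟩
  refine ⟨x, (Lp.stronglyMeasurable x).measurable, Lp.memLp x, fun n => ?_⟩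
  have h1 : pertOp d hd x n = c n := by rw [hx]
  rw [← h1, pertOp_apply]
  simp only [d, exp_mul_chr]

end Perturbation

/-! ### Arcs under folding. -/

/-- For `0 ≤ β ≤ 1` the indicator of the arc of the circle of length `β` starting at `p`. -/
noncomputable def arc (p β t : ℝ) : ℤ := ⌊t - p⌋ - ⌊t - p - β⌋

theorem arc_add_intCast (p β : ℝ) (k : ℤ) (t : ℝ) : arc p (β + k) t = arc p β t + k := by
  unfold arc
  rw [show t - p - (β + k) = t - p - β - k by ring, Int.floor_sub_intCast]; ring

theorem arc_zero (p t : ℝ) : arc p 0 t = 0 := by simp [arc]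

theorem arc_one (p t : ℝ) : arc p 1 t = 1 := by
  have := arc_add_intCast p 0 1 t
  simpa [arc_zero] using this

theorem arc_eq_ite {p β : ℝ} (h0 : 0 ≤ β) (h1 : β < 1) (t : ℝ) :
    arc p β t = if Int.fract (t - p) < β then 1 else 0 := by
  have ha := Int.floor_add_fract (t - p)
  have hb := Int.fract_nonneg (t - p)
  have hc := Int.fract_lt_one (t - p)
  unfold arc
  split_ifs with h
  · have : ⌊t - p - β⌋ = ⌊t - p⌋ - 1 := by
      rw [Int.floor_eq_iff]; push_cast; constructor <;> linarith
    omega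
  · have : ⌊t - p - β⌋ = ⌊t - p⌋ := by
      rw [Int.floor_eq_iff]; constructor <;> linarith
    omega

theorem arc_mem {p β : ℝ} (h0 : 0 ≤ β) (h1 : β ≤ 1) (t : ℝ) : arc p β t = 0 ∨ arc p β t = 1 := by
  rcases h1.eq_or_lt with rfl | h1
  · exact Or.inr (arc_one p t)
  · rw [arc_eq_ite h0 h1]
    split_ifs <;> simp

theorem periodic_arc (p β : ℝ) : Function.Periodic (arc p β) 1 := fun t => by
  unfold arc
  rw [show t + 1 - p = t - p + 1 by ring, show t - p + 1 - β = t - p - β + 1 by ring,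
    Int.floor_add_one, Int.floor_add_one]
  ring

theorem measurable_arc (p β : ℝ) : Measurable (arc p β) :=
  (Int.measurable_floor.comp (measurable_id.sub_const p)).sub
    (Int.measurable_floor.comp ((measurable_id.sub_const p).sub_const β))

theorem fold_arc {N : ℕ} (hN : 0 < N) (p β : ℝ) : fold N (arc p β) = arc (N * p) (N * β) := by
  ext t
  unfold fold arc
  rw [Finset.sum_sub_distrib, sum_floor_div N hN]
  simp only [sub_sub]
  rw [sum_floor_div N hN, mul_add]

/-- The nearest point of the unit interval. -/
noncomputable def clamp (x : ℝ) : ℝ := max 0 (min 1 x)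

/-- For arbitrary real `β`, `arc p β` is the constant `⌊β⌋` plus the indicator of an arc of length
`Int.fract β`: lower levels are full, higher ones empty, and only level `⌊β⌋` can be a proper arc.
-/
theorem level_arc (n : ℕ) (p : ℝ) {β : ℝ} : level n (arc p β) = arc p (clamp (β - n)) := by
  ext t
  have h1 : arc p β t = arc p (Int.fract β) t + ⌊β⌋ := by
    rw [← arc_add_intCast, Int.fract_add_floor]
  have hle := Int.floor_le β
  have hlt := Int.lt_floor_add_one β
  have hm := arc_mem (p := p) (Int.fract_nonneg β) (Int.fract_lt_one β).le t
  unfold level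
  rcases lt_trichotomy (n : ℤ) ⌊β⌋ with h | h | h
  · have h' : (n : ℝ) + 1 ≤ ⌊β⌋ := by exact_mod_cast h
    have : clamp (β - n) = 1 := by
      rw [clamp, min_eq_left (by linarith), max_eq_right zero_le_one]
    rw [this, arc_one, if_pos (by omega)]
  · have h' : (n : ℝ) = ⌊β⌋ := by exact_mod_cast h
    have : clamp (β - n) = Int.fract β := by
      rw [h', Int.self_sub_floor, clamp, min_eq_right (Int.fract_lt_one β).le,
        max_eq_right (Int.fract_nonneg β)]
    rw [this, h1]
    split_ifs <;> omega
  · have h' : (⌊β⌋ : ℝ) + 1 ≤ n := by exact_mod_cast h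
    have : clamp (β - n) = 0 := by
      rw [clamp, max_eq_left]
      exact (min_le_right _ _).trans (by linarith)
    rw [this, arc_zero, if_neg (by omega)]

theorem rieszPair_zero {f : ℝ → ℤ} (hf : ∀ t, f t = 0) : RieszPair f ∅ :=
  ⟨fun _ _ hs _ => Eventually.of_forall fun t => hs t (hf t),
    fun _ _ => ⟨fun _ => 0, L2per.zero, fun _ _ => rfl, fun _ hn => hn.elim⟩⟩

theorem rieszPair_one {f : ℝ → ℤ} (hf : ∀ t, f t = 1) : RieszPair f Set.univ :=
  ⟨fun _ hg _ h0 => hg.ae_eq_zero fun n => h0 n trivial,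
    fun h hh => ⟨h, hh, fun t ht => by rw [hf t] at ht; exact absurd ht one_ne_zero,
      fun _ _ => rfl⟩⟩

/-! ### Short arcs. -/

section smallArc

variable {p β : ℝ}

/-- The substitution `t = β * y + p` carries the arc to the unit interval. The starting point enters
only through the unimodular factor `chr l p`, which is why one frequency set serves all translates.
-/
theorem fc_eq_of_support_arc (h0 : 0 < β) (h1 : β < 1) {g : ℝ → ℂ} (hg : L2per g)
    (hs : ∀ t, arc p β t = 0 → g t = 0) (l : ℤ) :
    fc g l = β * chr l p * ∫ y in (0 : ℝ)..1, g (β * y + p) *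
      Complex.exp (-(2 * Real.pi * Complex.I * (β * l) * y)) := by
  have hint := (hg.mul_chr l).intervalIntegrable
  have h2 : fc g l = ∫ t in p..(p + 1), g t * chr l t := by
    have := (hg.mul_chr l).periodic.intervalIntegral_add_eq 0 p
    rwa [zero_add] at this
  have h3 : ∫ t in (p + β)..(p + 1), g t * chr l t = 0 := by
    rw [intervalIntegral.integral_congr_Ioo_of_le (g := fun _ => (0 : ℂ)) (by linarith)
      fun t ht => ?_]
    · simp
    · have hfr : Int.fract (t - p) = t - p := by
        rw [Int.fract_eq_self]; constructor <;> linarith [ht.1, ht.2]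
      rw [hs t (by rw [arc_eq_ite h0.le h1, if_neg (by rw [hfr]; linarith [ht.1])]), zero_mul]
  have h4 : ∫ y in (0 : ℝ)..1, g (β * y + p) * chr l (β * y + p) =
      (β : ℂ)⁻¹ * ∫ t in p..(p + β), g t * chr l t := by
    rw [intervalIntegral.integral_comp_mul_add (fun t => g t * chr l t) h0.ne']
    simp only [mul_zero, zero_add, mul_one, Complex.real_smul, Complex.ofReal_inv]
    rw [add_comm β p]
  have hβ : (β : ℂ) ≠ 0 := by exact_mod_cast h0.ne'
  rw [h2, ← intervalIntegral.integral_add_adjacent_intervals (hint p (p + β)) (hint _ _), h3,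
    add_zero]
  have h5 : ∀ y : ℝ, g (β * y + p) * chr l (β * y + p) = chr l p * (g (β * y + p) *
      Complex.exp (-(2 * Real.pi * Complex.I * (β * l) * y))) := by
    intro y
    rw [chr_add]
    have : chr l (β * y) = Complex.exp (-(2 * Real.pi * Complex.I * (β * l) * y)) := by
      unfold chr; push_cast; ring_nf
    rw [this]; ring
  simp only [h5] at h4
  rw [intervalIntegral.integral_const_mul] at h4
  rw [mul_assoc, h4, mul_inv_cancel_left₀ hβ]

theorem L2per.memLp_comp_mul_add {g : ℝ → ℂ} (hg : L2per g) (h0 : 0 < β) :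
    MemLp (fun y => g (β * y + p)) 2 (volume.restrict (Set.Ioc (0 : ℝ) 1)) := by
  have hm : Measurable fun y => g (β * y + p) :=
    hg.measurable.comp ((measurable_const_mul β).add_const p)
  rw [memLp_two_iff_integrable_sq_norm hm.aestronglyMeasurable]
  refine (intervalIntegrable_iff_integrableOn_Ioc_of_le zero_le_one).1 ?_
  have h := ((hg.intervalIntegrable_sq p (β + p)).comp_add_right p).comp_mul_left (c := β)
  simpa [div_self h0.ne'] using h

theorem ae_eq_zero_of_support_arc (h0 : 0 < β) (h1 : β < 1) {g : ℝ → ℂ} (hg : L2per g)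
    (hs : ∀ t, arc p β t = 0 → g t = 0)
    (h : (fun y => g (β * y + p)) =ᵐ[volume.restrict (Set.Ioc (0 : ℝ) 1)] 0) :
    ∀ᵐ t, g t = 0 := by
  have hβ := h0.ne'
  have hq : Measure.QuasiMeasurePreserving (fun t : ℝ => β⁻¹ * t) volume volume := by
    refine ⟨measurable_const_mul _, ?_⟩
    rw [Real.map_volume_mul_left (inv_ne_zero hβ)]
    exact Measure.smul_absolutelyContinuous
  have h2 : ∀ᵐ t : ℝ, β⁻¹ * t ∈ Set.Ioc (0 : ℝ) 1 → g (t + p) = 0 := by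
    have h' := (ae_restrict_iff' measurableSet_Ioc).1 h
    filter_upwards [hq.ae h'] with t ht ht'
    have := ht ht'
    rwa [mul_inv_cancel_left₀ hβ] at this
  have h3 : ∀ᵐ t, g (t + p) = 0 := by
    refine ae_of_ae_restrict_Ioc (fun t => ?_) ?_
    · rw [show t + 1 + p = t + p + 1 by ring, hg.periodic]
    · rw [ae_restrict_iff' measurableSet_Ioc]
      have hne : ∀ᵐ t : ℝ, t ≠ 1 := by simp [ae_iff]
      filter_upwards [h2, hne] with t ht htne htI
      by_cases hle : t ≤ β
      · refine ht ⟨by have := htI.1; positivity, ?_⟩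
        rw [inv_mul_le_iff₀ h0]; linarith
      · refine hs _ ?_
        have hfr : Int.fract (t + p - p) = t := by
          rw [add_sub_cancel_right, Int.fract_eq_self]
          exact ⟨htI.1.le, lt_of_le_of_ne htI.2 htne⟩
        rw [arc_eq_ite h0.le h1, hfr, if_neg (by linarith)]
  filter_upwards [(measurePreserving_sub_right volume p).quasiMeasurePreserving.ae h3] with t ht
  simpa using ht

theorem exists_L2per_support_arc (h0 : 0 < β) (h1 : β < 1) {G : ℝ → ℂ} (hGm : Measurable G)
    (hG : MemLp G 2 (volume.restrict (Set.Ioc (0 : ℝ) 1))) :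
    ∃ g, L2per g ∧ (∀ t, arc p β t = 0 → g t = 0) ∧
      ∀ y ∈ Set.Ioo (0 : ℝ) 1, g (β * y + p) = G y := by
  have hβ := h0.ne'
  set g : ℝ → ℂ := fun s => if Int.fract (s - p) < β then G (β⁻¹ * Int.fract (s - p)) else 0
    with hgdef
  have hfm : Measurable fun s : ℝ => Int.fract (s - p) :=
    measurable_fract.comp (measurable_id.sub_const p)
  have hgp : Function.Periodic g 1 := fun s => by
    simp only [hgdef, show s + 1 - p = s - p + 1 by ring, Int.fract_add_one]
  have hfr : ∀ s ∈ Set.Ioo p (p + 1), Int.fract (s - p) = s - p := fun s hs => by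
    rw [Int.fract_eq_self]; constructor <;> linarith [hs.1, hs.2]
  have hi1 : IntervalIntegrable (fun t => ‖g t‖ ^ 2) volume p (p + β) := by
    have hGi : IntervalIntegrable (fun t => ‖G t‖ ^ 2) volume 0 1 := by
      rw [intervalIntegrable_iff_integrableOn_Ioc_of_le zero_le_one]
      exact (memLp_two_iff_integrable_sq_norm hG.1).1 hG
    have h2 := (hGi.comp_mul_left (c := β⁻¹)).comp_sub_right p
    rw [zero_div, div_inv_eq_mul, one_mul, zero_add, add_comm β p,
      intervalIntegrable_iff_integrableOn_Ioo_of_le (by linarith)] at h2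
    rw [intervalIntegrable_iff_integrableOn_Ioo_of_le (by linarith)]
    refine h2.congr_fun (fun s hs => ?_) measurableSet_Ioo
    simp only [hgdef]
    rw [hfr s ⟨hs.1, by linarith [hs.2]⟩, if_pos (by linarith [hs.2])]
  have hi2 : IntervalIntegrable (fun t => ‖g t‖ ^ 2) volume (p + β) (p + 1) := by
    rw [intervalIntegrable_iff_integrableOn_Ioo_of_le (by linarith)]
    refine (integrableOn_zero (ε' := ℝ)).congr_fun (fun s hs => ?_) measurableSet_Ioo
    simp only [hgdef]
    rw [hfr s ⟨by linarith [hs.1], hs.2⟩, if_neg (by linarith [hs.1])]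
    simp
  refine ⟨g, ⟨?_, hgp, ?_⟩, fun t ht => ?_, fun y hy => ?_⟩
  · exact Measurable.ite (measurableSet_lt hfm measurable_const)
      (hGm.comp (hfm.const_mul _)) measurable_const
  · exact Function.Periodic.intervalIntegrable (T := 1) (t := p)
      (fun t => by simp only [hgp t]) one_ne_zero (hi1.trans hi2) 0 1
  · rw [arc_eq_ite h0.le h1] at ht
    simp only [hgdef]
    exact if_neg fun h => by rw [if_pos h] at ht; exact one_ne_zero ht
  · simp only [hgdef]
    have h2 : 0 < β * y := mul_pos h0 hy.1
    have h3 : β * y < β := by nlinarith [hy.2]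
    rw [hfr _ ⟨by linarith, by linarith⟩, add_sub_cancel_right, if_pos h3,
      inv_mul_cancel_left₀ hβ]

/-- After rescaling, the integer frequency nearest to `n / β` becomes `n` with error at most `β / 2
≤ 1 / 20`. Such errors also keep the rounded frequencies distinct. -/
theorem exists_rieszPair_smallArc (h0 : 0 < β) (h1 : β ≤ 1 / 10) :
    ∃ Λ : Set ℤ, ∀ p, RieszPair (arc p β) Λ := by
  have hlt : β < 1 := by linarith
  have hβ := h0.ne'
  set lam : ℤ → ℤ := fun n => round ((n : ℝ) / β) with hlam
  set ε : ℤ → ℝ := fun n => β * lam n - n with hεdef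
  have hε : ∀ n, |ε n| ≤ 1 / 20 := by
    intro n
    have h2 := abs_sub_round ((n : ℝ) / β)
    have h3 : ε n = -(β * ((n : ℝ) / β - lam n)) := by
      simp only [hεdef]; field_simp; ring
    rw [h3, abs_neg, abs_mul, abs_of_pos h0]
    nlinarith [abs_nonneg ((n : ℝ) / β - lam n)]
  have hinj : Function.Injective lam := by
    intro m n hmn
    have hm := abs_le.1 (hε m)
    have hn := abs_le.1 (hε n)
    simp only [hεdef, hmn] at hm hn
    have h2 : (m : ℝ) - n < 1 := by linarith [hm.1, hn.2]
    have h3 : (n : ℝ) - m < 1 := by linarith [hm.2, hn.1]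
    have h2' : m - n < 1 := by exact_mod_cast h2
    have h3' : n - m < 1 := by exact_mod_cast h3
    omega
  have hexp : ∀ (n : ℤ) (y : ℝ), Complex.exp (-(2 * Real.pi * Complex.I * (n + ε n) * y)) =
      Complex.exp (-(2 * Real.pi * Complex.I * (β * lam n) * y)) := by
    intro n y
    congr 4
    simp only [hεdef]; push_cast; ring
  refine ⟨Set.range lam, fun p => ⟨fun g hg hs hz => ?_, fun h hh => ?_⟩⟩
  · refine ae_eq_zero_of_support_arc h0 hlt hg hs
      (ae_eq_zero_of_perturbed ε hε (hg.memLp_comp_mul_add h0) fun n => ?_)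
    have h2 := hz (lam n) ⟨n, rfl⟩
    rw [fc_eq_of_support_arc h0 hlt hg hs] at h2
    have h3 : (β : ℂ) * chr (lam n) p ≠ 0 :=
      mul_ne_zero (by exact_mod_cast hβ) (chr_ne_zero _ _)
    simp only [hexp]
    exact (mul_eq_zero.1 h2).resolve_left h3
  · have hsum : Summable fun n => ‖(β * chr (lam n) p)⁻¹ * fc h (lam n)‖ ^ 2 := by
      have := (hh.summable_sq_fc.comp_injective hinj).mul_left ((β⁻¹) ^ 2)
      refine this.congr fun n => ?_
      simp only [Function.comp_apply, norm_mul, norm_inv, norm_chr, mul_one, Complex.norm_real,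
        Real.norm_of_nonneg h0.le, mul_pow]
    obtain ⟨G, hGm, hG, hGc⟩ := exists_of_perturbed ε hε hsum
    obtain ⟨g, hg, hgs, hgG⟩ := exists_L2per_support_arc (p := p) h0 hlt hGm hG
    refine ⟨g, hg, hgs, ?_⟩
    rintro _ ⟨n, rfl⟩
    have h3 : (β : ℂ) * chr (lam n) p ≠ 0 :=
      mul_ne_zero (by exact_mod_cast hβ) (chr_ne_zero _ _)
    rw [fc_eq_of_support_arc h0 hlt hg hgs]
    have h4 := hGc n
    simp only [hexp] at h4
    rw [intervalIntegral.integral_congr_Ioo_of_le zero_le_one fun y hy => by rw [hgG y hy], h4,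
      mul_inv_cancel_left₀ h3]

end smallArc

/-! ### Arcs of arbitrary length. -/

theorem exists_fract_nat_mul_le (β : ℝ) : ∃ N : ℕ, 0 < N ∧ Int.fract (N * β) ≤ 1 / 10 := by
  -- Dirichlet approximation with error at most `1 / 20`; the sign of the error decides the case.
  obtain ⟨k, hk0, -, hk⟩ := Real.exists_nat_abs_mul_sub_round_le β (n := 19) (by norm_num)
  set r := round ((k : ℝ) * β) with hr
  have hk' := abs_le.1 hk
  norm_num at hk'
  rcases le_or_gt (r : ℝ) (k * β) with h | h
  · refine ⟨k, hk0, ?_⟩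
    have : Int.fract ((k : ℝ) * β) = k * β - r := by
      rw [Int.fract_eq_iff]
      exact ⟨by linarith, by linarith, r, by ring⟩
    rw [this]; linarith
  · set e : ℝ := r - k * β with he
    have he0 : 0 < e := by linarith
    -- When `k * β` falls short of an integer by `e ≤ 1 / 20`, the least multiple of `e` reaching `9
    -- / 10` is still below `1`, and then `M * k * β` lies at most `1 / 10` above an integer.
    obtain ⟨M, hM1, hM2⟩ : ∃ M : ℕ, 9 / 10 ≤ M * e ∧ M * e < 1 := by
      refine ⟨⌈(9 / 10) / e⌉₊, ?_, ?_⟩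
      · rw [← div_le_iff₀ he0]; exact Nat.le_ceil _
      · have h2 := Nat.ceil_lt_add_one (show 0 ≤ (9 / 10) / e by positivity)
        have h3 : (9 / 10) / e * e = 9 / 10 := by field_simp
        nlinarith
    have hM0 : 0 < M := by
      rcases Nat.eq_zero_or_pos M with h0 | h0
      · rw [h0] at hM1; norm_num at hM1
      · exact h0
    refine ⟨M * k, Nat.mul_pos hM0 hk0, ?_⟩
    have : Int.fract (((M * k : ℕ) : ℝ) * β) = 1 - M * e := by
      rw [Int.fract_eq_iff]
      refine ⟨by linarith, ?_, M * r - 1, ?_⟩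
      · have : (0 : ℝ) < M := by exact_mod_cast hM0
        nlinarith
      · push_cast; rw [he]; ring
    rw [this]; linarith

theorem clamp_cases (N n : ℕ) {β : ℝ} (h : Int.fract (N * β) ≤ 1 / 10) :
    clamp (N * β - n) = 0 ∨ clamp (N * β - n) = 1 ∨
      0 < clamp (N * β - n) ∧ clamp (N * β - n) ≤ 1 / 10 := by
  have ha := Int.floor_add_fract ((N : ℝ) * β)
  rcases le_or_gt ((N : ℝ) * β - n) 0 with h0 | h0
  · left
    rw [clamp, max_eq_left ((min_le_right _ _).trans h0)]
  rcases le_or_gt 1 ((N : ℝ) * β - n) with h1 | h1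
  · right; left
    rw [clamp, min_eq_left h1, max_eq_right zero_le_one]
  · right; right
    rw [clamp, min_eq_right h1.le, max_eq_right h0.le]
    refine ⟨h0, ?_⟩
    have : Int.fract ((N : ℝ) * β) = N * β - n := by
      rw [Int.fract_eq_iff]
      exact ⟨h0.le, h1, n, by push_cast; ring⟩
    linarith

theorem exists_rieszPair_arc {β : ℝ} (h0 : 0 ≤ β) (h1 : β ≤ 1) :
    ∃ Λ : Set ℤ, ∀ p, RieszPair (arc p β) Λ := by
  obtain ⟨N, hN, hfr⟩ := exists_fract_nat_mul_le β
  have H : ∀ n : ℕ, ∃ Λ : Set ℤ, ∀ p, RieszPair (arc p (clamp (N * β - n))) Λ := by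
    intro n
    rcases clamp_cases N n hfr with h | h | h
    · exact ⟨∅, fun p => rieszPair_zero fun t => by rw [h, arc_zero]⟩
    · exact ⟨Set.univ, fun p => rieszPair_one fun t => by rw [h, arc_one]⟩
    · exact exists_rieszPair_smallArc h.1 h.2
  choose Λ hΛ using H
  refine ⟨{m | m / (N : ℤ) ∈ Λ (m % (N : ℤ)).toNat}, fun p => ?_⟩
  refine rieszPair_of_fold hN (measurable_arc p β) (periodic_arc p β) (arc_mem h0 h1)
    fun n _ => ?_
  rw [fold_arc hN, level_arc]
  exact hΛ n _

/-- One choice depending on the length only, normalised at the lengths `0` and `1` so that levels of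
different arcs can be compared. -/
theorem exists_arc_frequencies : ∃ Λ : ℝ → Set ℤ, Λ 0 = ∅ ∧ Λ 1 = Set.univ ∧
    ∀ β, 0 ≤ β → β ≤ 1 → ∀ p, RieszPair (arc p β) (Λ β) := by
  have H : ∀ β : ℝ, ∃ Λ : Set ℤ, (β = 0 → Λ = ∅) ∧ (β = 1 → Λ = Set.univ) ∧
      (0 ≤ β → β ≤ 1 → ∀ p, RieszPair (arc p β) Λ) := by
    intro β
    by_cases hb0 : β = 0
    · exact ⟨∅, fun _ => rfl, fun h => by norm_num [hb0] at h, fun _ _ p =>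
        rieszPair_zero fun t => by rw [hb0, arc_zero]⟩
    by_cases hb1 : β = 1
    · exact ⟨Set.univ, fun h => absurd h hb0, fun _ => rfl, fun _ _ p =>
        rieszPair_one fun t => by rw [hb1, arc_one]⟩
    by_cases hb : 0 ≤ β ∧ β ≤ 1
    · obtain ⟨Λ, hΛ⟩ := exists_rieszPair_arc hb.1 hb.2
      exact ⟨Λ, fun h => absurd h hb0, fun h => absurd h hb1, fun _ _ => hΛ⟩
    · exact ⟨∅, fun _ => rfl, fun h => absurd h hb1, fun h h' => absurd ⟨h, h'⟩ hb⟩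
  choose Λ h1 h2 h3 using H
  exact ⟨Λ, h1 0 rfl, h2 1 rfl, h3⟩

/-! ### Nested families of arcs. -/

/-- Lengths are compared without integrals: after folding, the value of an arc function differs from
`N` times its length by less than one. -/
theorem arc_length_le {p q a b : ℝ} (h : ∀ t, arc p a t ≤ arc q b t) : a ≤ b := by
  by_contra! hab
  obtain ⟨N, hN⟩ := exists_nat_gt (2 / (a - b))
  have hpos : 0 < a - b := by linarith
  rw [div_lt_iff₀ hpos] at hN
  have hN0 : 0 < N := by
    rcases Nat.eq_zero_or_pos N with h0 | h0
    · rw [h0] at hN; norm_num at hN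
    · exact h0
  have h1 : fold N (arc p a) 0 ≤ fold N (arc q b) 0 := Finset.sum_le_sum fun j _ => h _
  rw [fold_arc hN0, fold_arc hN0] at h1
  have h2 : ∀ x c : ℝ, (c - 1 : ℝ) < arc x c 0 ∧ (arc x c 0 : ℝ) < c + 1 := by
    intro x c
    unfold arc
    push_cast
    have := Int.floor_le (0 - x)
    have := Int.lt_floor_add_one (0 - x)
    have := Int.floor_le (0 - x - c)
    have := Int.lt_floor_add_one (0 - x - c)
    constructor <;> linarith
  have h3 := (h2 (N * p) (N * a)).1
  have h4 := (h2 (N * q) (N * b)).2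
  have h5 : (arc (N * p) (N * a) 0 : ℝ) ≤ arc (N * q) (N * b) 0 := by exact_mod_cast h1
  nlinarith

/-- A monotone family of indicator functions has nested Riesz bases. -/
def HasNestedBases {ι : Type*} [Preorder ι] (f : ι → ℝ → ℤ) : Prop :=
  ∃ Λ : ι → Set ℤ, Monotone Λ ∧ ∀ k, RieszPair (f k) (Λ k)

/-- At each level, two arcs of different lengths cannot both be proper once `N` is large, and the
frequency sets `∅` and `Set.univ` are comparable with anything. Arcs of equal length receive the
same frequencies. -/
theorem hasNestedBases_of_arcs {ι : Type*} [Finite ι] [Preorder ι] {f : ι → ℝ → ℤ}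
    (hf : Monotone f) (ha : ∀ k, ∃ p β, 0 ≤ β ∧ β ≤ 1 ∧ f k = arc p β) : HasNestedBases f := by
  choose p β hβ0 hβ1 hfe using ha
  obtain ⟨Λ, hΛ0, hΛ1, hΛ⟩ := exists_arc_frequencies
  have hβ : Monotone β := fun k l hkl => arc_length_le (p := p k) (q := p l) fun t => by
    rw [← hfe, ← hfe]; exact hf hkl t
  obtain ⟨N, hN, hN0⟩ : ∃ N : ℕ, (∀ k l, β k < β l → 2 ≤ N * (β l - β k)) ∧ 0 < N := by
    have h1 : ∀ k l, ∀ᶠ N : ℕ in atTop, β k < β l → 2 ≤ N * (β l - β k) := by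
      intro k l
      by_cases h : β k < β l
      · have := (tendsto_natCast_atTop_atTop (R := ℝ)).atTop_mul_const (sub_pos.2 h)
        filter_upwards [this.eventually_ge_atTop 2] with N hN _ using hN
      · exact Eventually.of_forall fun N h' => absurd h' h
    exact ((eventually_all.2 fun k => eventually_all.2 fun l => h1 k l).and
      (eventually_gt_atTop 0)).exists
  have hcl : ∀ x, 0 ≤ clamp x ∧ clamp x ≤ 1 := fun x =>
    ⟨le_max_left _ _, max_le zero_le_one (min_le_left _ _)⟩
  refine ⟨fun k => {m | m / (N : ℤ) ∈ Λ (clamp (N * β k - (m % (N : ℤ)).toNat))},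
    fun k l hkl m hm => ?_, fun k => ?_⟩
  · simp only [Set.mem_ofPred_eq] at hm ⊢
    -- For unequal lengths, if the shorter level is nonempty then the longer one has `N * β l - n`
    -- above `2`, hence is the full circle.
    rcases (hβ hkl).eq_or_lt with h | h
    · rwa [← h]
    · have h2 := hN k l h
      rcases le_or_gt ((N : ℝ) * β k - (m % (N : ℤ)).toNat) 0 with h0 | h0
      · rw [clamp, max_eq_left ((min_le_right _ _).trans h0), hΛ0] at hm
        exact hm.elim
      · rw [clamp, min_eq_left (by linarith), max_eq_right zero_le_one, hΛ1]
        trivial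
  · rw [hfe]
    refine rieszPair_of_fold (Λ := fun n => Λ (clamp (N * β k - n))) hN0 (measurable_arc _ _)
      (periodic_arc _ _) (arc_mem (hβ0 k) (hβ1 k)) fun n _ => ?_
    rw [fold_arc hN0, level_arc]
    exact hΛ _ (hcl _).1 (hcl _).2 _

/-! ### The variance of step functions and averages over dilations. -/

theorem chr_neg (m : ℤ) (t : ℝ) : chr (-m) t = (starRingEnd ℂ) (chr m t) := by
  unfold chr
  rw [← Complex.exp_conj]
  congr 1
  simp only [map_neg, map_mul, Complex.conj_ofReal, Complex.conj_I, map_ofNat, map_intCast]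
  push_cast; ring

theorem chr_mul_neg (m : ℤ) (t : ℝ) : chr m (-t) = (starRingEnd ℂ) (chr m t) := by
  rw [← chr_neg]
  unfold chr
  congr 1
  push_cast; ring

theorem integral_chr {m : ℤ} (hm : m ≠ 0) (a b : ℝ) :
    ∫ t in a..b, chr m t = (chr m a - chr m b) / (2 * Real.pi * Complex.I * m) := by
  have hc : (-(2 * Real.pi * Complex.I * m) : ℂ) ≠ 0 := by
    simp [Real.pi_ne_zero, hm]
  have h := integral_exp_mul_complex (a := a) (b := b) hc
  have h2 : ∀ t : ℝ, chr m t = Complex.exp (-(2 * Real.pi * Complex.I * m) * t) := fun t => by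
    unfold chr; ring_nf
  simp only [h2]
  rw [h, ← neg_sub, neg_div_neg_eq]

theorem intervalIntegrable_floor_mul_chr (q : ℝ) (m : ℤ) (a b : ℝ) :
    IntervalIntegrable (fun t => (⌊t - q⌋ : ℂ) * chr m t) volume a b := by
  have h1 : Monotone fun t : ℝ => (⌊t - q⌋ : ℝ) := fun s t hst => by
    have : ⌊s - q⌋ ≤ ⌊t - q⌋ := Int.floor_le_floor (by linarith)
    exact Int.cast_le.2 this
  have h2 := h1.intervalIntegrable (μ := volume) (a := a) (b := b)
  have h3 : IntervalIntegrable (fun t => (⌊t - q⌋ : ℂ)) volume a b := by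
    have h4 : IntervalIntegrable (fun t => (((⌊t - q⌋ : ℝ)) : ℂ)) volume a b :=
      ⟨h2.1.ofReal, h2.2.ofReal⟩
    simpa only [Complex.ofReal_intCast] using h4
  exact h3.mul_continuousOn (continuous_chr m).continuousOn

theorem fc_floor (q : ℝ) {m : ℤ} (hm : m ≠ 0) :
    fc (fun t => (⌊t - q⌋ : ℂ)) m = (chr m q - 1) / (2 * Real.pi * Complex.I * m) := by
  have h0 : ∀ k : ℤ, chr m (k : ℝ) = 1 := fun k => by
    have := chr_add_int m 0 k
    rw [zero_add] at this
    rw [this]; simp [chr]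
  have hint := intervalIntegrable_floor_mul_chr q m
  have hq0 := Int.fract_nonneg q
  have hq1 := Int.fract_lt_one q
  have hqf := Int.floor_add_fract q
  have e1 : ∫ t in (0 : ℝ)..Int.fract q, (⌊t - q⌋ : ℂ) * chr m t =
      ∫ t in (0 : ℝ)..Int.fract q, (-⌊q⌋ - 1 : ℂ) * chr m t := by
    refine intervalIntegral.integral_congr_Ioo_of_le hq0 fun t ht => ?_
    have : ⌊t - q⌋ = -⌊q⌋ - 1 := by
      rw [Int.floor_eq_iff]; push_cast; constructor <;> linarith [ht.1, ht.2]
    simp only [this]; push_cast; ring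
  have e2 : ∫ t in Int.fract q..1, (⌊t - q⌋ : ℂ) * chr m t =
      ∫ t in Int.fract q..1, (-⌊q⌋ : ℂ) * chr m t := by
    refine intervalIntegral.integral_congr_Ioo_of_le hq1.le fun t ht => ?_
    have : ⌊t - q⌋ = -⌊q⌋ := by
      rw [Int.floor_eq_iff]; push_cast; constructor <;> linarith [ht.1, ht.2]
    simp only [this]; push_cast; ring
  have h1 : chr m 1 = 1 := by simpa using h0 1
  have h00 : chr m 0 = 1 := by simpa using h0 0
  have hfr : chr m (Int.fract q) = chr m q := by
    have := chr_add_int m (Int.fract q) ⌊q⌋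
    rw [Int.fract_add_floor] at this
    exact this.symm
  rw [fc, ← intervalIntegral.integral_add_adjacent_intervals (hint 0 (Int.fract q)) (hint _ 1),
    e1, e2, intervalIntegral.integral_const_mul, intervalIntegral.integral_const_mul,
    integral_chr hm, integral_chr hm, h1, h00, hfr]
  ring

section variance

variable {ι : Type*} (X : Finset ι) (w : ι → ℤ) (p : ι → ℝ)

/-- The Fourier coefficients of the jump measure of a step function. -/
noncomputable def jumpSum (m : ℤ) : ℂ := ∑ x ∈ X, (w x : ℂ) * chr m (p x)

/-- Differentiation in disguise: up to the factor `2πim`, the coefficients are those of the jump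
measure. The constant terms of the floor functions cancel because the weights sum to zero. -/
theorem fc_stair (hw : ∑ x ∈ X, w x = 0) (c : ℤ) {m : ℤ} (hm : m ≠ 0) :
    fc (fun t => (stair X w p c t : ℂ)) m = jumpSum X w p m / (2 * Real.pi * Complex.I * m) := by
  have h1 : ∀ t : ℝ, (stair X w p c t : ℂ) * chr m t =
      c * chr m t + ∑ x ∈ X, (w x : ℂ) * ((⌊t - p x⌋ : ℂ) * chr m t) := by
    intro t
    unfold stair
    push_cast
    rw [add_mul, Finset.sum_mul]
    simp only [mul_assoc]
  have hcst : ∫ t in (0 : ℝ)..1, (c : ℂ) * chr m t = 0 := by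
    have h2 : chr m 1 = chr m 0 := by simpa using periodic_chr m 0
    rw [intervalIntegral.integral_const_mul, integral_chr hm, h2, sub_self, zero_div, mul_zero]
  have hi : ∀ x ∈ X, IntervalIntegrable (fun t => (w x : ℂ) * ((⌊t - p x⌋ : ℂ) * chr m t))
      volume 0 1 := fun x _ => (intervalIntegrable_floor_mul_chr (p x) m 0 1).const_mul _
  have hw' : ∑ x ∈ X, (w x : ℂ) = 0 := by exact_mod_cast hw
  rw [fc]
  simp only [h1]
  rw [intervalIntegral.integral_add ((continuous_chr m).intervalIntegrable 0 1 |>.const_mul _)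
    (by simpa only [Finset.sum_fn] using IntervalIntegrable.sum X hi), hcst, zero_add,
    intervalIntegral.integral_finsetSum hi]
  have h3 : ∀ x ∈ X, ∫ t in (0 : ℝ)..1, (w x : ℂ) * ((⌊t - p x⌋ : ℂ) * chr m t) =
      (w x * chr m (p x) - w x) / (2 * Real.pi * Complex.I * m) := by
    intro x _
    have := fc_floor (p x) hm
    rw [fc] at this
    rw [intervalIntegral.integral_const_mul, this]
    ring
  rw [Finset.sum_congr rfl h3, ← Finset.sum_div, Finset.sum_sub_distrib, hw', sub_zero]
  rfl

theorem norm_jumpSum_neg (m : ℤ) : ‖jumpSum X w p (-m)‖ = ‖jumpSum X w p m‖ := by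
  have : jumpSum X w p (-m) = (starRingEnd ℂ) (jumpSum X w p m) := by
    unfold jumpSum
    rw [map_sum]
    refine Finset.sum_congr rfl fun x _ => ?_
    rw [chr_neg, map_mul]
    simp
  rw [this, RCLike.norm_conj]

theorem norm_sq_fc_stair (hw : ∑ x ∈ X, w x = 0) (c : ℤ) {m : ℤ} (hm : m ≠ 0) :
    ‖fc (fun t => (stair X w p c t : ℂ)) m‖ ^ 2 =
      ‖jumpSum X w p m‖ ^ 2 / (4 * Real.pi ^ 2 * m ^ 2) := by
  rw [fc_stair X w p hw c hm, norm_div, div_pow]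
  congr 1
  simp only [norm_mul, Complex.norm_ofNat, Complex.norm_real, Complex.norm_I, mul_one,
    Complex.norm_intCast, mul_pow, Real.norm_eq_abs, sq_abs]
  norm_num

/-- A step function that takes two adjacent values only has small variance. -/
theorem jumpSum_le_of_two_valued (hw : ∑ x ∈ X, w x = 0) (c v : ℤ)
    (h : ∀ t, stair X w p c t = v ∨ stair X w p c t = v + 1) :
    ‖jumpSum X w p 1‖ ^ 2 + ‖jumpSum X w p 2‖ ^ 2 / 4 ≤ Real.pi ^ 2 / 2 := by
  set F : ℝ → ℂ := fun t => (stair X w p c t : ℂ) with hF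
  have hm : Measurable (stair X w p c) := (isStep_stair X w p c hw).measurable
  have hmC : Measurable F := (measurable_from_top (f := fun k : ℤ => (k : ℂ))).comp hm
  have hmR : Measurable fun t => (stair X w p c t : ℝ) :=
    (measurable_from_top (f := fun k : ℤ => (k : ℝ))).comp hm
  have hb : ∀ t, |(stair X w p c t : ℝ)| ≤ |(v : ℝ)| + 1 := by
    intro t
    rcases h t with h | h <;> rw [h]
    · linarith
    · push_cast
      exact (abs_add_le _ _).trans (by simp)
  have hL : MemLp F 2 (volume.restrict (Set.Ioc (0 : ℝ) 1)) := by
    refine MemLp.of_bound hmC.aestronglyMeasurable (|(v : ℝ)| + 1) (Eventually.of_forall fun t => ?_)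
    rw [hF]
    simpa [Complex.norm_intCast] using hb t
  have hint : IntervalIntegrable (fun t => (stair X w p c t : ℝ)) volume 0 1 := by
    rw [intervalIntegrable_iff_integrableOn_Ioc_of_le zero_le_one]
    exact Integrable.of_bound hmR.aestronglyMeasurable (|(v : ℝ)| + 1)
      (Eventually.of_forall fun t => hb t)
  set C := ∫ t in (0 : ℝ)..1, (stair X w p c t : ℝ) with hC
  -- A function with values `v` and `v + 1` has a square that is affine in it, so its variance is
  -- `1/4 - (C - v - 1/2)^2`, where `C` is the mean.
  have hsq : ∫ t in (0 : ℝ)..1, ‖F t‖ ^ 2 = (2 * v + 1) * C - v * (v + 1) := by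
    have : ∀ t, ‖F t‖ ^ 2 = (2 * v + 1) * (stair X w p c t : ℝ) - v * (v + 1) := by
      intro t
      simp only [hF, Complex.norm_intCast, sq_abs]
      rcases h t with h | h <;> rw [h] <;> push_cast <;> ring
    simp only [this]
    rw [intervalIntegral.integral_sub (hint.const_mul _) intervalIntegrable_const,
      intervalIntegral.integral_const_mul, ← hC]
    simp
  have hfc0 : ‖fc F 0‖ ^ 2 = C ^ 2 := by
    have : fc F 0 = (C : ℂ) := by
      rw [fc, hC, ← intervalIntegral.integral_ofReal]
      refine intervalIntegral.integral_congr fun t _ => ?_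
      simp [hF, chr]
    rw [this, Complex.norm_real, Real.norm_eq_abs, sq_abs]
  -- Parseval is truncated to frequencies of modulus at most two; keeping only `±1` would not
  -- suffice for the later contradiction.
  have hsum := sum_le_hasSum ({-2, -1, 0, 1, 2} : Finset ℤ) (fun n _ => by positivity)
    (hasSum_sq_fc_of_memLp hL)
  rw [hsq, Finset.sum_insert (by decide), Finset.sum_insert (by decide),
    Finset.sum_insert (by decide), Finset.sum_insert (by decide), Finset.sum_singleton, hfc0,
    hF, norm_sq_fc_stair X w p hw c (by norm_num), norm_sq_fc_stair X w p hw c (by norm_num),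
    norm_sq_fc_stair X w p hw c (by norm_num), norm_sq_fc_stair X w p hw c (by norm_num),
    norm_jumpSum_neg, norm_jumpSum_neg] at hsum
  push_cast at hsum
  set a := ‖jumpSum X w p 1‖ ^ 2
  set b := ‖jumpSum X w p 2‖ ^ 2
  have hpi : 0 < Real.pi ^ 2 := by have := Real.pi_pos; positivity
  have h1 : (a + b / 4) / (2 * Real.pi ^ 2) ≤ 1 / 4 := by
    have e : (a + b / 4) / (2 * Real.pi ^ 2) = b / (4 * Real.pi ^ 2 * (-2) ^ 2) +
        (a / (4 * Real.pi ^ 2 * (-1) ^ 2) + (a / (4 * Real.pi ^ 2 * 1 ^ 2) +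
          b / (4 * Real.pi ^ 2 * 2 ^ 2))) := by field_simp; ring
    rw [e]
    nlinarith [sq_nonneg (C - v - 1 / 2)]
  rw [div_le_iff₀ (by positivity)] at h1
  linarith

theorem tendsto_average_pow {r : ℂ} (hr : ‖r‖ = 1) :
    Tendsto (fun M : ℕ => (∑ N ∈ Finset.range M, r ^ (N + 1)) / (M : ℂ)) atTop
      (𝓝 (if r = 1 then 1 else 0)) := by
  split_ifs with h
  · subst h
    refine tendsto_const_nhds.congr' ?_
    filter_upwards [eventually_gt_atTop 0] with M hM
    have : (M : ℂ) ≠ 0 := by exact_mod_cast hM.ne'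
    simp [div_self this]
  · have h1 : r - 1 ≠ 0 := sub_ne_zero.2 h
    rw [tendsto_zero_iff_norm_tendsto_zero]
    refine squeeze_zero (fun _ => norm_nonneg _) (fun M => ?_)
      (tendsto_const_div_atTop_nhds_zero_nat (2 / ‖r - 1‖))
    rw [norm_div, Complex.norm_natCast]
    gcongr
    have : ∑ N ∈ Finset.range M, r ^ (N + 1) = r * ((r ^ M - 1) / (r - 1)) := by
      rw [← geom_sum_eq h, Finset.mul_sum]
      exact Finset.sum_congr rfl fun N _ => by ring
    rw [this, norm_mul, hr, one_mul, norm_div]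
    gcongr
    refine (norm_sub_le _ _).trans ?_
    rw [norm_pow, hr, one_pow, norm_one]; norm_num

theorem norm_sq_jumpSum (m : ℤ) (N : ℕ) :
    ((‖jumpSum X w (fun x => N * p x) m‖ ^ 2 : ℝ) : ℂ) =
      ∑ x ∈ X, ∑ y ∈ X, (w x : ℂ) * w y * chr m (p x - p y) ^ N := by
  rw [← Complex.normSq_eq_norm_sq, ← Complex.mul_conj, jumpSum, map_sum, Finset.sum_mul_sum]
  refine Finset.sum_congr rfl fun x _ => Finset.sum_congr rfl fun y _ => ?_
  have h1 : ∀ t : ℝ, chr m (N * t) = chr m t ^ N := fun t => by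
    rw [← chr_mul_nat]
    unfold chr
    rw [← Complex.exp_nat_mul]; push_cast; ring_nf
  rw [sub_eq_add_neg, chr_add, chr_mul_neg, map_mul, h1, h1, mul_pow, map_pow]
  simp only [map_intCast]
  ring

/-- Expand the square: averaging over dilations keeps exactly the pairs with `m * (p x - p y)` an
integer, since the other geometric sums stay bounded. -/
theorem tendsto_average_jumpSum (m : ℤ) :
    Tendsto (fun M : ℕ => (∑ N ∈ Finset.range M,
        ‖jumpSum X w (fun x => ((N + 1 : ℕ) : ℝ) * p x) m‖ ^ 2) / (M : ℝ)) atTop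
      (𝓝 (∑ x ∈ X, ∑ y ∈ X, (w x : ℝ) * w y * (if chr m (p x - p y) = 1 then 1 else 0))) := by
  have h : Tendsto (fun M : ℕ => ∑ x ∈ X, ∑ y ∈ X, (w x : ℂ) * w y *
      ((∑ N ∈ Finset.range M, chr m (p x - p y) ^ (N + 1)) / (M : ℂ))) atTop
      (𝓝 (∑ x ∈ X, ∑ y ∈ X, (w x : ℂ) * w y * (if chr m (p x - p y) = 1 then 1 else 0))) :=
    tendsto_finsetSum _ fun x _ => tendsto_finsetSum _ fun y _ =>
      (tendsto_average_pow (norm_chr m _)).const_mul _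
  have h2 := (Complex.continuous_re.tendsto _).comp h
  convert h2 using 1
  · ext M
    rw [Function.comp_apply, ← Complex.ofReal_re (_ / _)]
    congr 1
    push_cast
    simp only [← Complex.ofReal_pow]
    have h3 : ∀ N : ℕ, (((N : ℝ) + 1)) = ((N + 1 : ℕ) : ℝ) := fun N => by push_cast; rfl
    simp only [h3, norm_sq_jumpSum]
    rw [Finset.sum_comm, Finset.sum_div]
    refine Finset.sum_congr rfl fun x _ => ?_
    rw [Finset.sum_comm, Finset.sum_div]
    refine Finset.sum_congr rfl fun y _ => ?_
    rw [← Finset.mul_sum, mul_div_assoc]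
  · congr 1
    rw [← Complex.ofReal_re (∑ x ∈ X, _)]
    congr 1
    push_cast
    refine Finset.sum_congr rfl fun x _ => Finset.sum_congr rfl fun y _ => ?_
    split_ifs <;> simp

/-- If points at rational distance carry weights of the same sign, then some dilation of the jump
measure has large Fourier coefficients. -/
theorem exists_large_jumpSum (h4 : 4 ≤ ∑ x ∈ X, (w x) ^ 2)
    (hs : ∀ x ∈ X, ∀ y ∈ X, ∀ m : ℕ, 0 < m → ∀ k : ℤ, m * (p x - p y) = k → 0 ≤ w x * w y) :
    ∃ N : ℕ, 0 < N ∧ Real.pi ^ 2 / 2 < ‖jumpSum X w (fun x => (N : ℝ) * p x) 1‖ ^ 2 +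
      ‖jumpSum X w (fun x => (N : ℝ) * p x) 2‖ ^ 2 / 4 := by
  by_contra! hcon
  -- The surviving off-diagonal terms belong to points at rational distance and are nonnegative by
  -- `hs`; the diagonal contributes at least `4`.
  have hlow : ∀ m : ℕ, 0 < m → (4 : ℝ) ≤ ∑ x ∈ X, ∑ y ∈ X, (w x : ℝ) * w y *
      (if chr m (p x - p y) = 1 then 1 else 0) := by
    intro m hm
    have h4' : (4 : ℝ) ≤ ∑ x ∈ X, (w x : ℝ) ^ 2 := by exact_mod_cast h4
    refine h4'.trans (Finset.sum_le_sum fun x hx => ?_)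
    have hnn : ∀ y ∈ X, 0 ≤ (w x : ℝ) * w y * (if chr m (p x - p y) = 1 then 1 else 0) := by
      intro y hy
      split_ifs with h
      · unfold chr at h
        rw [Complex.exp_eq_one_iff] at h
        obtain ⟨k, hk⟩ := h
        have h3 : (2 * Real.pi * Complex.I : ℂ) ≠ 0 := by
          simp [Real.pi_ne_zero]
        have h5 : (m : ℂ) * (p x - p y) = ((-k : ℤ) : ℂ) := by
          refine mul_left_cancel₀ h3 ?_
          push_cast at hk ⊢
          linear_combination -hk
        have := hs x hx y hy m hm (-k) (by exact_mod_cast h5)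
        rw [mul_one]
        exact_mod_cast this
      · simp
    refine le_trans ?_ (Finset.single_le_sum hnn hx)
    rw [sub_self, if_pos (by simp [chr])]
    linarith [sq (w x : ℝ)]
  have hlim := (tendsto_average_jumpSum X w p 1).add ((tendsto_average_jumpSum X w p 2).div_const 4)
  have hle := le_of_tendsto hlim (b := Real.pi ^ 2 / 2) (by
    filter_upwards [eventually_gt_atTop 0] with M hM
    have hM' : (0 : ℝ) < M := by exact_mod_cast hM
    rw [div_right_comm, ← add_div, div_le_iff₀ hM', Finset.sum_div, ← Finset.sum_add_distrib]
    calc _ ≤ ∑ N ∈ Finset.range M, Real.pi ^ 2 / 2 :=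
          Finset.sum_le_sum fun N _ => hcon (N + 1) (Nat.succ_pos N)
      _ = _ := by simp [mul_comm])
  -- The limiting average is at least `4 + 4 / 4 = 5`, whereas `π < 3.15` gives `π² / 2 < 5`. The
  -- frequency `1` alone would yield `4`, below `π² / 2`.
  have h1 := hlow 1 one_pos
  have h2 := hlow 2 two_pos
  have hpi := Real.pi_lt_d2
  have hpi0 := Real.pi_pos
  push_cast at h1 h2
  nlinarith

end variance

/-! ### Reducing the number of jumps. -/

section reduction

variable {f : ℝ → ℤ}

theorem totalJump_const {f : ℝ → ℤ} (c : ℤ) (h : ∀ t, f t = c) : totalJump f = 0 := by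
  have : f = fun _ => c := funext h
  rw [this, totalJump_eq_sum ∅ (by simp)]
  · simp
  · intro x _ hx
    exact absurd (HasJump.const c x).jump_eq hx

theorem IsStep.jump_eq_one_or (hf : IsStep f) (h01 : ∀ t, f t = 0 ∨ f t = 1) {x : ℝ}
    (hx : x ∈ hf.jumps) : jump f x = 1 ∨ jump f x = -1 := by
  obtain ⟨y, hy⟩ := (hf.hasJump_jump x).1.exists
  have h0 := (hf.mem_jumps.1 hx).2
  rcases h01 x with h1 | h1 <;> rcases h01 y with h2 | h2 <;> omega

theorem IsStep.totalJump_eq_card (hf : IsStep f) (h01 : ∀ t, f t = 0 ∨ f t = 1) :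
    totalJump f = hf.jumps.card := by
  rw [hf.totalJump_eq, Finset.card_eq_sum_ones]
  refine Finset.sum_congr rfl fun x hx => ?_
  rcases hf.jump_eq_one_or h01 hx with h | h <;> rw [h] <;> rfl

/-- The jumps are `±1` and sum to zero. Hence more than two jumps means at least four, as the
averaging argument requires. -/
theorem IsStep.even_totalJump (hf : IsStep f) (h01 : ∀ t, f t = 0 ∨ f t = 1) :
    Even (totalJump f) := by
  rw [hf.totalJump_eq_card h01]
  have h1 := hf.sum_jump
  have h2 : (2 : ℤ) ∣ ∑ x ∈ hf.jumps, (1 - jump f x) := by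
    refine Finset.dvd_sum fun x hx => ?_
    rcases hf.jump_eq_one_or h01 hx with h | h <;> rw [h] <;> norm_num
  rw [Finset.sum_sub_distrib, h1, sub_zero] at h2
  simp only [Finset.sum_const, nsmul_eq_mul, mul_one] at h2
  exact even_iff_two_dvd.2 (by exact_mod_cast h2)

/-- Folding so that jumps of opposite sign collide decreases the total jump. -/
theorem IsStep.totalJump_fold_lt (hf : IsStep f) (h01 : ∀ t, f t = 0 ∨ f t = 1) {x y : ℝ}
    (hx : x ∈ hf.jumps) (hy : y ∈ hf.jumps) (hxy : jump f x * jump f y < 0) {m : ℕ} (hm : 0 < m)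
    {k : ℤ} (hk : m * (x - y) = k) : totalJump (_root_.fold m f) < totalJump f := by
  obtain ⟨c, hc⟩ := hf.eq_stair
  have hne : y ≠ x := by
    rintro rfl
    exact absurd hxy (not_lt.2 (mul_self_nonneg _))
  have hsum : jump f x + jump f y = 0 := by
    rcases hf.jump_eq_one_or h01 hx with h | h <;> rcases hf.jump_eq_one_or h01 hy with h' | h' <;>
      rw [h, h'] at hxy <;> omega
  have hy' : y ∈ hf.jumps.erase x := Finset.mem_erase.2 ⟨hne, hy⟩
  have hfold : _root_.fold m f = stair ((hf.jumps.erase x).erase y) (jump f)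
      (fun z => m * id z) (m * c - jump f x * k) := by
    conv_lhs => rw [hc, fold_stair _ _ _ _ m hm]
    ext t
    unfold stair
    rw [← Finset.add_sum_erase _ _ hx, ← Finset.add_sum_erase _ _ hy']
    have h1 : ⌊t - m * y⌋ = ⌊t - m * x⌋ + k := by
      rw [← Int.floor_add_intCast, ← hk]
      congr 1; ring
    have h2 : jump f y = -jump f x := by omega
    simp only [id] at *
    rw [h1, h2]
    ring
  rw [hfold]
  refine (totalJump_stair_le _ _ _ _).trans_lt ?_
  rw [hf.totalJump_eq, ← Finset.add_sum_erase _ _ hx, ← Finset.add_sum_erase _ _ hy']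
  have := Int.natAbs_pos.2 (hf.mem_jumps.1 hx).2
  omega

/-- If level `n` uses up all the jumps, every other level is constant. A value below `n` would then
make level `n` empty, and a value above `n + 1` would make it full. -/
theorem two_valued_of_totalJump_level {F : ℝ → ℤ} (hF : IsStep F) (h0 : ∀ t, 0 ≤ F t) {n : ℕ}
    (hpos : 0 < totalJump (level n F)) (hn : totalJump F ≤ totalJump (level n F)) (t : ℝ) :
    F t = n ∨ F t = n + 1 := by
  have hconst : ∀ m, m ≠ n → ∃ c, ∀ t, level m F t = c := by
    intro m hm
    refine (hF.level m).eq_const_of_totalJump ?_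
    have := hF.totalJump_level_add_le hm
    omega
  have hnc : ∀ c, ¬ ∀ t, level n F t = c := fun c hc => by
    have := totalJump_const c hc
    omega
  by_contra! hne
  rcases lt_or_ge (F t) n with h | h
  · obtain ⟨m, rfl⟩ : ∃ m, n = m + 1 := ⟨n - 1, by have := h0 t; omega⟩
    obtain ⟨c, hc⟩ := hconst m (by omega)
    refine hnc 0 fun s => ?_
    have h1 := (hc s).trans (hc t).symm
    unfold level at h1 ⊢
    push_cast at *
    split_ifs at * <;> omega
  · obtain ⟨c, hc⟩ := hconst (n + 1) (by omega)
    refine hnc 1 fun s => ?_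
    have h1 := (hc s).trans (hc t).symm
    unfold level at h1 ⊢
    push_cast at *
    split_ifs at * <;> omega

/-- Otherwise every `N` has a level with as many jumps as `f`. This excludes opposite jumps at
rational distance, so the averaging bound applies, and it makes every folding two-valued, so the
variance bound contradicts it. -/
theorem IsStep.exists_fold_totalJump_lt (hf : IsStep f) (h01 : ∀ t, f t = 0 ∨ f t = 1)
    (hJ : 4 ≤ totalJump f) :
    ∃ N : ℕ, 0 < N ∧ ∀ n, totalJump (_root_.level n (_root_.fold N f)) < totalJump f := by
  by_contra! hcon
  obtain ⟨c, hc⟩ := hf.eq_stair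
  obtain ⟨N, hN, hlarge⟩ := exists_large_jumpSum hf.jumps (jump f) id (by
      have h1 : ∑ x ∈ hf.jumps, (jump f x) ^ 2 = ∑ x ∈ hf.jumps, 1 :=
        Finset.sum_congr rfl fun x hx => by
          rcases hf.jump_eq_one_or h01 hx with h | h <;> rw [h] <;> norm_num
      rw [h1, Finset.sum_const, nsmul_eq_mul, mul_one]
      rw [hf.totalJump_eq_card h01] at hJ
      exact_mod_cast hJ) (by
    intro x hx y hy m hm k hk
    by_contra! hneg
    obtain ⟨n, hn⟩ := hcon m hm
    have h1 := hf.totalJump_fold_lt h01 hx hy hneg hm hk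
    have h2 := (hf.fold hm).totalJump_level_le n
    omega)
  obtain ⟨n, hn⟩ := hcon N hN
  have hle := hf.totalJump_fold_le hN
  have h0 : ∀ t, 0 ≤ _root_.fold N f t := fun t => Finset.sum_nonneg fun j _ => by
    rcases h01 ((t + j) / N) with h | h <;> rw [h]; norm_num
  have h2 := two_valued_of_totalJump_level (hf.fold hN) h0 (n := n) (by omega) (by omega)
  rw [hc, fold_stair _ _ _ _ N hN] at h2
  have h3 := jumpSum_le_of_two_valued _ _ _ hf.sum_jump _ _ h2
  linarith

theorem IsStep.eq_arc (hf : IsStep f) (h01 : ∀ t, f t = 0 ∨ f t = 1) (hJ : totalJump f ≤ 2) :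
    ∃ p β, 0 ≤ β ∧ β ≤ 1 ∧ f = arc p β := by
  obtain ⟨c, hc⟩ := hf.eq_stair
  have hsum := hf.sum_jump
  have hcard := hf.totalJump_eq_card h01
  have h012 : hf.jumps.card = 0 ∨ hf.jumps.card = 1 ∨ hf.jumps.card = 2 := by omega
  rcases h012 with h | h | h
  · obtain ⟨c, hc⟩ := hf.eq_const_of_totalJump (hcard.trans h)
    rcases h01 0 with h0 | h0
    · exact ⟨0, 0, le_rfl, zero_le_one, funext fun t => by rw [hc, ← hc 0, h0, arc_zero]⟩
    · exact ⟨0, 1, zero_le_one, le_rfl, funext fun t => by rw [hc, ← hc 0, h0, arc_one]⟩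
  · obtain ⟨x, hx⟩ := Finset.card_eq_one.1 h
    rw [hx, Finset.sum_singleton] at hsum
    exact absurd hsum (hf.mem_jumps.1 (by rw [hx]; exact Finset.mem_singleton_self x)).2
  · have key : ∀ x y, x ≠ y → hf.jumps = {x, y} → jump f x = 1 → ∃ p β, 0 ≤ β ∧ β ≤ 1 ∧
        f = arc p β := by
      intro x y hxy hX hx1
      have hxX : x ∈ hf.jumps := by rw [hX]; simp
      have hyX : y ∈ hf.jumps := by rw [hX]; simp
      have hxI := (hf.mem_jumps.1 hxX).1
      have hyI := (hf.mem_jumps.1 hyX).1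
      have hy1 : jump f y = -1 := by
        rw [hX, Finset.sum_pair hxy] at hsum
        omega
      have hb0 : 0 < Int.fract (y - x) := by
        refine lt_of_le_of_ne (Int.fract_nonneg _) fun h0 => hxy ?_
        have := (fract_sub_eq_zero_iff hyI).1 h0.symm
        rw [this, Int.fract_eq_self.2 hxI]
      have hb1 := Int.fract_lt_one (y - x)
      have hform : ∀ t, f t = (c + ⌊y - x⌋) + arc x (Int.fract (y - x)) t := by
        intro t
        have h1 : f t = c + arc x (y - x) t := by
          conv_lhs => rw [hc]
          unfold stair arc
          rw [hX, Finset.sum_pair hxy, hx1, hy1]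
          simp only [id, sub_sub, add_sub_cancel]
          ring
        have h2 := arc_add_intCast x (Int.fract (y - x)) ⌊y - x⌋ t
        rw [Int.fract_add_floor] at h2
        rw [h1, h2]; ring
      -- Inside the arc `f` exceeds its value outside by one; both values lie in `{0, 1}`, so the
      -- constant vanishes.
      have hC : c + ⌊y - x⌋ = 0 := by
        have e1 := hform x
        have e2 := hform (x + Int.fract (y - x))
        rw [arc_eq_ite hb0.le hb1, sub_self, Int.fract_zero, if_pos hb0] at e1
        rw [arc_eq_ite hb0.le hb1, add_sub_cancel_left, Int.fract_fract, if_neg (lt_irrefl _)] at e2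
        rcases h01 x with h | h <;> rcases h01 (x + Int.fract (y - x)) with h' | h' <;> omega
      exact ⟨x, Int.fract (y - x), hb0.le, hb1.le, funext fun t => by rw [hform, hC, zero_add]⟩
    obtain ⟨x, y, hxy, hX⟩ := Finset.card_eq_two.1 h
    have hxX : x ∈ hf.jumps := by rw [hX]; simp
    rcases hf.jump_eq_one_or h01 hxX with h1 | h1
    · exact key x y hxy hX h1
    · refine key y x hxy.symm (by rw [hX, Finset.pair_comm]) ?_
      rw [hX, Finset.sum_pair hxy] at hsum
      omega

theorem fold_mono {f g : ℝ → ℤ} (h : f ≤ g) (N : ℕ) : fold N f ≤ fold N g :=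
  fun _ => Finset.sum_le_sum fun _ _ => h _

theorem level_mono {f g : ℝ → ℤ} (h : f ≤ g) (n : ℕ) : level n f ≤ level n g := fun t => by
  have h1 : f t ≤ g t := h t
  change level n f t ≤ level n g t
  unfold level
  split_ifs <;> omega

/-- Monotone families of indicators of finite unions of arcs have nested Riesz bases. -/
theorem hasNestedBases {ι : Type*} [Fintype ι] [Preorder ι] (f : ι → ℝ → ℤ) (hf : Monotone f)
    (hstep : ∀ k, IsStep (f k)) (h01 : ∀ k t, f k t = 0 ∨ f k t = 1) : HasNestedBases f := by
  -- The same `N` must serve all members of the family, so the measure is the total over the family: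
  -- folding chosen for `k₀` lowers its term at every level and raises no other.
  induction hs : ∑ k, totalJump (f k) using Nat.strong_induction_on generalizing f with
  | _ s ih =>
    by_cases hex : ∃ k, 2 < totalJump (f k)
    · obtain ⟨k₀, hk₀⟩ := hex
      obtain ⟨N, hN, hlt⟩ := (hstep k₀).exists_fold_totalJump_lt (h01 k₀) (by
        obtain ⟨r, hr⟩ := (hstep k₀).even_totalJump (h01 k₀)
        omega)
      have H : ∀ n : ℕ, HasNestedBases fun k => level n (fold N (f k)) := by
        intro n
        refine ih _ ?_ _ (fun k l hkl => level_mono (fold_mono (hf hkl) N) n)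
          (fun k => ((hstep k).fold hN).level n) (fun k t => level_mem n _ t) rfl
        rw [← hs]
        refine Finset.sum_lt_sum (fun k _ => ?_) ⟨k₀, Finset.mem_univ _, hlt n⟩
        exact (((hstep k).fold hN).totalJump_level_le n).trans ((hstep k).totalJump_fold_le hN)
      choose Λ hΛm hΛ using H
      refine ⟨fun k => {m | m / (N : ℤ) ∈ Λ (m % (N : ℤ)).toNat k},
        fun k l hkl m hm => hΛm _ hkl hm, fun k => ?_⟩
      exact rieszPair_of_fold (Λ := fun n => Λ n k) hN (hstep k).measurable (hstep k).periodic
        (h01 k) fun n _ => hΛ n k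
    · push Not at hex
      exact hasNestedBases_of_arcs hf fun k => (hstep k).eq_arc (h01 k) (hex k)

end reduction

/-! ### Riesz bases in an abstract Hilbert space. -/

section abstract

variable {ι H : Type*} [NormedAddCommGroup H] [InnerProductSpace ℂ H] [CompleteSpace H]

/-- The analysis operator of a family. -/
noncomputable def analysisMap (f : ι → H) (hmem : ∀ g, Memℓp (fun i => inner ℂ (f i) g) 2) :
    H →ₗ[ℂ] lp (fun _ : ι => ℂ) 2 where
  toFun g := ⟨fun i => inner ℂ (f i) g, hmem g⟩
  map_add' x y := by ext i; exact inner_add_right _ _ _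
  map_smul' a x := by ext i; exact inner_smul_right _ _ _

/-- Closed graph theorem: each coordinate is continuous, and coordinates determine the limit. -/
theorem continuous_analysisMap (f : ι → H) (hmem : ∀ g, Memℓp (fun i => inner ℂ (f i) g) 2) :
    Continuous (analysisMap f hmem) := by
  refine LinearMap.continuous_of_seq_closed_graph _ fun u x y hu hy => ?_
  ext i
  have h1 : Tendsto (fun n => inner ℂ (f i) (u n)) atTop (𝓝 (inner ℂ (f i) x)) :=
    tendsto_const_nhds.inner hu
  have h2 := ((lp.evalCLM ℂ (fun _ : ι => ℂ) 2 i).continuous.tendsto y).comp hy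
  exact tendsto_nhds_unique h2 h1

/-- A family whose analysis operator is a bijection onto the square summable sequences is a Riesz
basis. -/
theorem isRieszBasis_of_bijective (f : ι → H)
    (hmem : ∀ g, Memℓp (fun i => inner ℂ (f i) g) 2)
    (hinj : ∀ g, (∀ i, inner ℂ (f i) g = 0) → g = 0)
    (hsurj : ∀ c : lp (fun _ : ι => ℂ) 2, ∃ g, ∀ i, inner ℂ (f i) g = c i) : IsRieszBasis f := by
  classical
  have hbij : Function.Bijective (analysisMap f hmem) := by
    refine ⟨(injective_iff_map_eq_zero _).2 fun g hg => hinj g fun i => ?_, fun c => ?_⟩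
    · exact congrArg (fun c : lp (fun _ : ι => ℂ) 2 => c i) hg
    · obtain ⟨g, hg⟩ := hsurj c
      exact ⟨g, by ext i; exact hg i⟩
  let e : H ≃L[ℂ] lp (fun _ : ι => ℂ) 2 :=
    (LinearEquiv.ofBijective _ hbij).toContinuousLinearEquivOfContinuous
      (continuous_analysisMap f hmem)
  let C : H →L[ℂ] lp (fun _ : ι => ℂ) 2 := e
  let D : lp (fun _ : ι => ℂ) 2 →L[ℂ] H := e.symm
  have hC : ∀ g i, C g i = inner ℂ (f i) g := fun g i => rfl
  have hDC : D ∘L C = ContinuousLinearMap.id ℂ H := by ext x; exact e.symm_apply_apply x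
  have hCD : C ∘L D = ContinuousLinearMap.id ℂ _ := by ext1 x; exact e.apply_symm_apply x
  -- Polar decomposition `C = U P` with `P` the positive root of `C* C` and `U` unitary. Since `f i`
  -- is `C*` applied to the `i`-th unit vector, it is `P` applied to the orthonormal vector that `U`
  -- sends to that unit vector.
  let R : H →L[ℂ] H := C.adjoint ∘L C
  have hRpos : 0 ≤ R := by
    rw [ContinuousLinearMap.nonneg_iff_isPositive]
    exact ContinuousLinearMap.isPositive_adjoint_comp_self C
  have hRbij : Function.Bijective R := by
    have h1 : Function.Bijective C.adjoint := by
      refine Function.bijective_iff_has_inverse.2 ⟨D.adjoint, fun x => ?_, fun x => ?_⟩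
      · have := congrArg ContinuousLinearMap.adjoint hCD
        rw [ContinuousLinearMap.adjoint_comp, ContinuousLinearMap.adjoint_id] at this
        exact congrArg (fun L : _ →L[ℂ] _ => L x) this
      · have := congrArg ContinuousLinearMap.adjoint hDC
        rw [ContinuousLinearMap.adjoint_comp, ContinuousLinearMap.adjoint_id] at this
        exact congrArg (fun L : _ →L[ℂ] _ => L x) this
    exact h1.comp e.bijective
  set P : H →L[ℂ] H := CFC.sqrt R with hP
  have hPP : P * P = R := CFC.sqrt_mul_sqrt_self R hRpos
  have hPsa : IsSelfAdjoint P := (CFC.sqrt_nonneg R).isSelfAdjoint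
  have hPsym : ∀ x y, inner ℂ (P x) y = inner ℂ x (P y) := fun x y => by
    rw [← ContinuousLinearMap.adjoint_inner_right, hPsa.adjoint_eq]
  have hPbij : Function.Bijective P := by
    have h1 : (P : H → H) ∘ P = R := by
      rw [← hPP]; rfl
    rw [← h1] at hRbij
    exact ⟨Function.Injective.of_comp hRbij.1, Function.Surjective.of_comp hRbij.2⟩
  let T : H ≃L[ℂ] H := ContinuousLinearEquiv.ofBijective P
    (LinearMap.ker_eq_bot.2 hPbij.1) (LinearMap.range_eq_top.2 hPbij.2)
  have hT : ∀ x, T x = P x := fun x => rfl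
  have hnorm : ∀ x, ‖C x‖ = ‖P x‖ := by
    intro x
    have h1 : inner ℂ (C x) (C x) = inner ℂ (P x) (P x) := by
      rw [hPsym, ← ContinuousLinearMap.adjoint_inner_right]
      have : P (P x) = R x := by rw [← hPP]; rfl
      rw [this]; rfl
    rw [inner_self_eq_norm_sq_to_K, inner_self_eq_norm_sq_to_K] at h1
    have h2 : ‖C x‖ ^ 2 = ‖P x‖ ^ 2 := by exact_mod_cast h1
    exact (sq_eq_sq₀ (norm_nonneg _) (norm_nonneg _)).1 h2
  let U : H ≃ₗᵢ[ℂ] lp (fun _ : ι => ℂ) 2 :=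
    { (T.symm.trans e).toLinearEquiv with
      norm_map' := fun x => by
        change ‖C (T.symm x)‖ = ‖x‖
        rw [hnorm, ← hT, T.apply_symm_apply] }
  have hU : ∀ x, U (T x) = C x := fun x => by
    change e (T.symm (T x)) = e x
    rw [T.symm_apply_apply]
  refine ⟨HilbertBasis.ofRepr U, T, fun i => ?_⟩
  refine ext_inner_right ℂ fun g => ?_
  have h1 : (HilbertBasis.ofRepr U : HilbertBasis ι ℂ H) i = U.symm (lp.single 2 i (1 : ℂ)) :=
    ((HilbertBasis.ofRepr U : HilbertBasis ι ℂ H).repr_symm_single i).symm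
  have h2 : inner ℂ (U.symm (lp.single 2 i (1 : ℂ))) (T g) = inner ℂ (f i) g := by
    rw [← U.inner_map_map, U.apply_symm_apply, hU, lp.inner_single_left, hC]
    simp
  rw [hT, hPsym, ← hT, h1, h2]

end abstract

/-! ### From periodic functions to `L²` of a subset of the unit interval. -/

section concrete

variable {f : ℝ → ℤ}

/-- Square integrable functions on a subset of the unit interval extend periodically by zero. -/
theorem exists_periodic_extension (hm : Measurable f) (hp : Function.Periodic f 1) {g : ℝ → ℂ}
    (hg : Measurable g)
    (hL : MemLp g 2 (volume.restrict (Set.Ioc (0 : ℝ) 1 ∩ f ⁻¹' {1}))) :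
    ∃ G, L2per G ∧ (∀ t, f t = 0 → G t = 0) ∧
      ∀ t ∈ Set.Ioc (0 : ℝ) 1 ∩ f ⁻¹' {1}, G t = g t := by
  have hms : MeasurableSet (f ⁻¹' {1}) := hm (measurableSet_singleton 1)
  set G : ℝ → ℂ := (f ⁻¹' {1}).indicator fun t => g (t - ⌈t⌉ + 1) with hG
  have hGm : Measurable G := by
    refine Measurable.indicator (hg.comp ?_) hms
    exact ((measurable_id.sub ((measurable_from_top (f := fun k : ℤ => (k : ℝ))).comp
      Int.measurable_ceil)).add_const 1)
  have hGp : Function.Periodic G 1 := by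
    intro t
    simp only [hG, Set.indicator, Set.mem_preimage, hp t]
    rw [Int.ceil_add_one]
    push_cast
    rw [show t + 1 - (⌈t⌉ + 1) + 1 = t - ⌈t⌉ + 1 by ring]
  have hI : ∀ t ∈ Set.Ioc (0 : ℝ) 1, G t = (f ⁻¹' {1}).indicator g t := by
    intro t ht
    have : ⌈t⌉ = 1 := by rw [Int.ceil_eq_iff]; push_cast; constructor <;> linarith [ht.1, ht.2]
    simp only [hG, Set.indicator, this]
    norm_num
  refine ⟨G, L2per.of_memLp hGm hGp ?_, fun t ht => ?_, fun t ht => ?_⟩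
  · rw [Set.inter_comm, ← Measure.restrict_restrict hms, ← memLp_indicator_iff_restrict hms] at hL
    refine hL.ae_eq ?_
    filter_upwards [ae_restrict_mem measurableSet_Ioc] with t ht
    exact (hI t ht).symm
  · refine Set.indicator_of_notMem (fun h => ?_) _
    have h' : f t = 1 := h
    omega
  · rw [hI t ht.1, Set.indicator_of_mem ht.2]

theorem setIntegral_eq_fc (h01 : ∀ t, f t = 0 ∨ f t = 1) {G : ℝ → ℂ}
    (hs : ∀ t, f t = 0 → G t = 0) (n : ℤ) :
    ∫ t in Set.Ioc (0 : ℝ) 1 ∩ f ⁻¹' {1}, G t * chr n t = fc G n := by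
  rw [fc, intervalIntegral.integral_of_le zero_le_one]
  refine (setIntegral_eq_of_subset_of_forall_sdiff_eq_zero measurableSet_Ioc
    Set.inter_subset_left fun t ht => ?_).symm
  have : f t = 0 := (h01 t).resolve_right fun h => ht.2 ⟨ht.1, h⟩
  rw [hs t this, zero_mul]

theorem expFun_eq_conj_chr (n : ℤ) (t : ℝ) : expFun n t = (starRingEnd ℂ) (chr n t) := by
  rw [← chr_neg, expFun, chr]
  congr 1
  push_cast; ring

/-- Extension by zero identifies `L²` of the set with periodic functions supported on it, and inner
products with exponentials become Fourier coefficients; the two halves of `RieszPair` are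
injectivity and surjectivity of the analysis operator. -/
theorem isExpRieszBasis_of_rieszPair (hm : Measurable f) (hp : Function.Periodic f 1)
    (h01 : ∀ t, f t = 0 ∨ f t = 1) {Λ : Set ℤ} (h : RieszPair f Λ) :
    IsExpRieszBasis (fun n : Λ => ((n : ℤ) : ℝ)) (Set.Ioc (0 : ℝ) 1 ∩ f ⁻¹' {1}) := by
  set E : Set ℝ := Set.Ioc (0 : ℝ) 1 ∩ f ⁻¹' {1} with hE
  have hEm : MeasurableSet E := measurableSet_Ioc.inter (hm (measurableSet_singleton 1))
  have hfin : IsFiniteMeasure (volume.restrict E) := by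
    refine ⟨?_⟩
    rw [Measure.restrict_apply_univ]
    exact (measure_mono Set.inter_subset_left).trans_lt measure_Ioc_lt_top
  have hexp : ∀ n : ℤ, MemLp (expFun n) 2 (volume.restrict E) := by
    intro n
    refine MemLp.of_bound (C := 1) ?_ (Eventually.of_forall fun t => ?_)
    · refine Continuous.aestronglyMeasurable ?_
      unfold expFun; fun_prop
    · rw [expFun_eq_conj_chr, RCLike.norm_conj, norm_chr]
  have hinner : ∀ (n : ℤ) (g : Lp ℂ 2 (volume.restrict E)) (G : ℝ → ℂ),
      (∀ t, f t = 0 → G t = 0) → G =ᵐ[volume.restrict E] g →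
      inner ℂ ((hexp n).toLp (expFun n)) g = fc G n := by
    intro n g G hs hG
    rw [L2.inner_def, ← setIntegral_eq_fc h01 hs]
    refine integral_congr_ae ?_
    filter_upwards [(hexp n).coeFn_toLp, hG] with t h1 h2
    rw [h1, h2, expFun_eq_conj_chr]
    simp
  have hext : ∀ g : Lp ℂ 2 (volume.restrict E), ∃ G, L2per G ∧ (∀ t, f t = 0 → G t = 0) ∧
      G =ᵐ[volume.restrict E] g := by
    intro g
    obtain ⟨G, hG, hs, hGg⟩ := exists_periodic_extension hm hp
      (Lp.stronglyMeasurable g).measurable (Lp.memLp g)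
    exact ⟨G, hG, hs, (ae_restrict_iff' hEm).2 (Eventually.of_forall hGg)⟩
  have hac : ∀ {P : ℝ → Prop}, (∀ᵐ t, P t) → ∀ᵐ t ∂volume.restrict E, P t := fun hP =>
    ae_restrict_of_ae hP
  refine ⟨fun n => (hexp n).toLp (expFun n), fun n => (hexp n).coeFn_toLp,
    isRieszBasis_of_bijective _ (fun g => ?_) (fun g hg => ?_) fun c => ?_⟩
  · obtain ⟨G, hG, hs, hGg⟩ := hext g
    simp only [hinner _ g G hs hGg]
    exact memℓp_two_of_summable (hG.summable_sq_fc.comp_injective Subtype.val_injective)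
  · obtain ⟨G, hG, hs, hGg⟩ := hext g
    have h0 := h.1 G hG hs fun n hn => by
      rw [← hinner n g G hs hGg]; exact hg ⟨n, hn⟩
    rw [Lp.eq_zero_iff_ae_eq_zero]
    filter_upwards [hGg, hac h0] with t h1 h2
    rw [← h1, h2]; rfl
  · classical
    -- Extending the data by zero off `Λ` and applying Riesz–Fischer gives a periodic function to
    -- feed to the surjectivity half.
    let c' : ℤ → ℂ := fun n => if hn : n ∈ Λ then c ⟨n, hn⟩ else 0
    have hc' : ∀ n : Λ, c' n = c n := fun n => dif_pos n.2
    have hsum : Summable fun n => ‖c' n‖ ^ 2 := by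
      refine (Subtype.val_injective.summable_iff (g := ((↑) : Λ → ℤ)) fun n hn => ?_).1 ?_
      · have : n ∉ Λ := by simpa using hn
        simp [c', this]
      · have := (lp.memℓp c).summable (by simp)
        simp only [ENNReal.toReal_ofNat, Real.rpow_ofNat] at this
        refine this.congr fun n => ?_
        rw [Function.comp_apply, hc']
    obtain ⟨h', hh', hfc⟩ := exists_L2per_fc_eq ⟨c', memℓp_two_of_summable hsum⟩
    obtain ⟨G, hG, hs, hGf⟩ := h.2 h' hh'
    have hGL : MemLp G 2 (volume.restrict E) :=
      hG.memLp.mono_measure (Measure.restrict_mono Set.inter_subset_left le_rfl)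
    refine ⟨hGL.toLp G, fun n => ?_⟩
    rw [hinner n _ G hs hGL.coeFn_toLp.symm, hGf n n.2, hfc]
    exact hc' n

end concrete

/-! ### Local behaviour of finite unions of intervals. -/

section intervals

theorem Set.OrdConnected.eventually_nhdsGT {I : Set ℝ} (hI : I.OrdConnected) (x : ℝ) :
    (∀ᶠ y in 𝓝[>] x, y ∈ I) ∨ ∀ᶠ y in 𝓝[>] x, y ∉ I := by
  by_cases h : ∃ᶠ y in 𝓝[>] x, y ∈ I
  · left
    obtain ⟨z, hz, hxz⟩ := (h.and_eventually self_mem_nhdsWithin).exists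
    filter_upwards [Ioo_mem_nhdsGT hxz] with y hy
    obtain ⟨u, hu, hu'⟩ := (h.and_eventually (Ioo_mem_nhdsGT hy.1)).exists
    exact hI.out hu hz ⟨hu'.2.le, hy.2.le⟩
  · exact Or.inr (not_frequently.1 h)

theorem Set.OrdConnected.eventually_nhdsLT {I : Set ℝ} (hI : I.OrdConnected) (x : ℝ) :
    (∀ᶠ y in 𝓝[<] x, y ∈ I) ∨ ∀ᶠ y in 𝓝[<] x, y ∉ I := by
  by_cases h : ∃ᶠ y in 𝓝[<] x, y ∈ I
  · left
    obtain ⟨z, hz, hxz⟩ := (h.and_eventually self_mem_nhdsWithin).exists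
    filter_upwards [Ioo_mem_nhdsLT hxz] with y hy
    obtain ⟨u, hu, hu'⟩ := (h.and_eventually (Ioo_mem_nhdsLT hy.2)).exists
    exact hI.out hz hu ⟨hy.1.le, hu'.1.le⟩
  · exact Or.inr (not_frequently.1 h)

theorem eventually_mem_iUnion_or {ι : Type*} [Finite ι] {I : ι → Set ℝ} {l : Filter ℝ}
    (h : ∀ i, (∀ᶠ y in l, y ∈ I i) ∨ ∀ᶠ y in l, y ∉ I i) :
    (∀ᶠ y in l, y ∈ ⋃ i, I i) ∨ ∀ᶠ y in l, y ∉ ⋃ i, I i := by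
  by_cases hex : ∃ i, ∀ᶠ y in l, y ∈ I i
  · obtain ⟨i, hi⟩ := hex
    exact Or.inl (hi.mono fun y hy => Set.mem_iUnion.2 ⟨i, hy⟩)
  · right
    have : ∀ᶠ y in l, ∀ i, y ∉ I i :=
      eventually_all.2 fun i => (h i).resolve_left fun hi => hex ⟨i, hi⟩
    filter_upwards [this] with y hy
    simpa using hy

theorem IsFiniteUnionOfIntervals.eventually_nhdsGT {S : Set ℝ} (hS : IsFiniteUnionOfIntervals S)
    (x : ℝ) : (∀ᶠ y in 𝓝[>] x, y ∈ S) ∨ ∀ᶠ y in 𝓝[>] x, y ∉ S := by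
  obtain ⟨L, I, hI, rfl⟩ := hS
  exact eventually_mem_iUnion_or fun i => (hI i).eventually_nhdsGT x

theorem IsFiniteUnionOfIntervals.eventually_nhdsLT {S : Set ℝ} (hS : IsFiniteUnionOfIntervals S)
    (x : ℝ) : (∀ᶠ y in 𝓝[<] x, y ∈ S) ∨ ∀ᶠ y in 𝓝[<] x, y ∉ S := by
  obtain ⟨L, I, hI, rfl⟩ := hS
  exact eventually_mem_iUnion_or fun i => (hI i).eventually_nhdsLT x

theorem IsFiniteUnionOfIntervals.preimage_sub {S : Set ℝ} (hS : IsFiniteUnionOfIntervals S)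
    (k : ℝ) : IsFiniteUnionOfIntervals ((fun y => y - k) ⁻¹' S) := by
  obtain ⟨L, I, hI, rfl⟩ := hS
  refine ⟨L, fun l => (fun y => y - k) ⁻¹' I l, fun l => ?_, by rw [Set.preimage_iUnion]⟩
  exact (hI l).preimage_mono fun a b hab => by simpa using hab

/-- Intervals are convex, so their frontiers are null; off these frontiers membership is locally
constant. -/
theorem IsFiniteUnionOfIntervals.ae_eventually {S : Set ℝ} (hS : IsFiniteUnionOfIntervals S) :
    ∀ᵐ t, (∀ᶠ y in 𝓝 t, y ∈ S) ∨ ∀ᶠ y in 𝓝 t, y ∉ S := by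
  obtain ⟨L, I, hI, rfl⟩ := hS
  have h : ∀ i, ∀ᵐ t, t ∉ frontier (I i) := fun i =>
    measure_eq_zero_iff_ae_notMem.1 ((hI i).convex.addHaar_frontier volume)
  filter_upwards [ae_all_iff.2 h] with t ht
  refine eventually_mem_iUnion_or fun i => ?_
  by_cases hc : t ∈ closure (I i)
  · left
    have : t ∈ interior (I i) := by
      by_contra hn
      exact ht i ⟨hc, hn⟩
    exact mem_interior_iff_mem_nhds.1 this
  · right
    filter_upwards [isClosed_closure.isOpen_compl.mem_nhds hc] with y hy h
    exact hy (subset_closure h)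

end intervals

/-! ### Right-continuous indicators of finite unions of intervals. -/

section indicator

variable {S : Set ℝ}

open Classical in
/-- The right-continuous one-periodic function that indicates a subset of the unit interval. -/
noncomputable def stepOf (S : Set ℝ) (t : ℝ) : ℤ :=
  if ∀ᶠ y in 𝓝[>] t, Int.fract y ∈ S then 1 else 0

theorem stepOf_eq_zero_or_one (S : Set ℝ) (t : ℝ) : stepOf S t = 0 ∨ stepOf S t = 1 := by
  unfold stepOf; split_ifs <;> simp

theorem stepOf_eq_one {t : ℝ} (h : ∀ᶠ y in 𝓝[>] t, Int.fract y ∈ S) : stepOf S t = 1 := if_pos h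

theorem stepOf_eq_zero {t : ℝ} (h : ∀ᶠ y in 𝓝[>] t, Int.fract y ∉ S) : stepOf S t = 0 :=
  if_neg fun h' => by
    obtain ⟨y, h1, h2⟩ := (h.and h').exists
    exact h1 h2

theorem stepOf_mono {S T : Set ℝ} (h : S ⊆ T) (t : ℝ) : stepOf S t ≤ stepOf T t := by
  by_cases hS : ∀ᶠ y in 𝓝[>] t, Int.fract y ∈ S
  · rw [stepOf_eq_one hS, stepOf_eq_one (hS.mono fun y hy => h hy)]
  · have : stepOf S t = 0 := if_neg hS
    rw [this]
    rcases stepOf_eq_zero_or_one T t with h | h <;> simp [h]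

theorem eventually_nhdsGT_nhdsGT {P : ℝ → Prop} {x : ℝ} (h : ∀ᶠ y in 𝓝[>] x, P y) :
    ∀ᶠ y in 𝓝[>] x, ∀ᶠ z in 𝓝[>] y, P z := by
  filter_upwards [eventually_eventually_nhdsWithin.2 h, self_mem_nhdsWithin] with y hy hxy
  exact hy.filter_mono (nhdsWithin_mono y (Set.Ioi_subset_Ioi (le_of_lt hxy)))

theorem eventually_nhdsLT_nhdsGT {P : ℝ → Prop} {x : ℝ} (h : ∀ᶠ y in 𝓝[<] x, P y) :
    ∀ᶠ y in 𝓝[<] x, ∀ᶠ z in 𝓝[>] y, P z := by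
  filter_upwards [eventually_eventually_nhdsWithin.2 h, self_mem_nhdsWithin] with y hy hxy
  rw [isOpen_Iio.nhdsWithin_eq hxy] at hy
  exact hy.filter_mono nhdsWithin_le_nhds

theorem Int.eventually_fract_nhdsGT (x : ℝ) : ∀ᶠ y : ℝ in 𝓝[>] x, Int.fract y = y - ⌊x⌋ := by
  filter_upwards [Ioo_mem_nhdsGT (Int.lt_floor_add_one x)] with y hy
  rw [Int.fract, show ⌊y⌋ = ⌊x⌋ from Int.floor_eq_iff.2 ⟨(Int.floor_le x).trans hy.1.le, hy.2⟩]

theorem Int.eventually_fract_nhdsLT (x : ℝ) :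
    ∀ᶠ y in 𝓝[<] x, Int.fract y = y - ((⌈x⌉ - 1 : ℤ) : ℝ) := by
  have h : ((⌈x⌉ - 1 : ℤ) : ℝ) < x := by push_cast; linarith [Int.ceil_lt_add_one x]
  filter_upwards [Ioo_mem_nhdsLT h] with y hy
  rw [Int.fract, show ⌊y⌋ = ⌈x⌉ - 1 from Int.floor_eq_iff.2 ⟨hy.1.le, ?_⟩]
  push_cast
  linarith [Int.le_ceil x, hy.2]

namespace IsFiniteUnionOfIntervals

theorem eventually_fract_nhdsGT (hS : IsFiniteUnionOfIntervals S) (x : ℝ) :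
    (∀ᶠ y in 𝓝[>] x, Int.fract y ∈ S) ∨ ∀ᶠ y in 𝓝[>] x, Int.fract y ∉ S := by
  refine ((hS.preimage_sub ⌊x⌋).eventually_nhdsGT x).imp (fun h => ?_) fun h => ?_ <;>
  · filter_upwards [h, Int.eventually_fract_nhdsGT x] with y hy hf
    rwa [hf]

theorem eventually_fract_nhdsLT (hS : IsFiniteUnionOfIntervals S) (x : ℝ) :
    (∀ᶠ y in 𝓝[<] x, Int.fract y ∈ S) ∨ ∀ᶠ y in 𝓝[<] x, Int.fract y ∉ S := by
  refine ((hS.preimage_sub ((⌈x⌉ - 1 : ℤ) : ℝ)).eventually_nhdsLT x).imp (fun h => ?_)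
    fun h => ?_ <;>
  · filter_upwards [h, Int.eventually_fract_nhdsLT x] with y hy hf
    rwa [hf]

theorem stepOf_periodic (hS : IsFiniteUnionOfIntervals S) :
    Function.Periodic (stepOf S) 1 := by
  intro t
  have h : Tendsto (fun y : ℝ => y + 1) (𝓝[>] t) (𝓝[>] (t + 1)) :=
    (continuous_id.add continuous_const).continuousWithinAt.tendsto_nhdsWithin
      fun y hy => add_lt_add_left (Set.mem_Ioi.1 hy) 1
  rcases hS.eventually_fract_nhdsGT (t + 1) with h1 | h1
  · have h2 := h.eventually h1
    simp only [Int.fract_add_one] at h2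
    rw [stepOf_eq_one h1, stepOf_eq_one h2]
  · have h2 := h.eventually h1
    simp only [Int.fract_add_one] at h2
    rw [stepOf_eq_zero h1, stepOf_eq_zero h2]

theorem isStep_stepOf (hS : IsFiniteUnionOfIntervals S) : IsStep (stepOf S) := by
  refine ⟨hS.stepOf_periodic, fun x => ?_⟩
  have hr : ∀ᶠ y in 𝓝[>] x, stepOf S y = stepOf S x := by
    rcases hS.eventually_fract_nhdsGT x with h | h
    · filter_upwards [eventually_nhdsGT_nhdsGT h] with y hy
      rw [stepOf_eq_one h, stepOf_eq_one hy]
    · filter_upwards [eventually_nhdsGT_nhdsGT h] with y hy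
      rw [stepOf_eq_zero h, stepOf_eq_zero hy]
  rcases hS.eventually_fract_nhdsLT x with h | h
  · refine ⟨stepOf S x - 1, ?_, hr⟩
    filter_upwards [eventually_nhdsLT_nhdsGT h] with y hy
    rw [stepOf_eq_one hy]; ring
  · refine ⟨stepOf S x, ?_, hr⟩
    filter_upwards [eventually_nhdsLT_nhdsGT h] with y hy
    rw [stepOf_eq_zero hy]; ring

/-- Passing to right limits changes membership only at endpoints and at isolated points, a null set
that Riesz bases do not see. -/
theorem ae_eq_stepOf (hS : IsFiniteUnionOfIntervals S) (h01 : S ⊆ Set.Icc 0 1) :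
    S =ᵐ[volume] (Set.Ioc (0 : ℝ) 1 ∩ stepOf S ⁻¹' {1} : Set ℝ) := by
  have hne : ∀ a : ℝ, ∀ᵐ t, t ≠ a := fun a => by
    simp [ae_iff]
  rw [eventuallyEq_set]
  filter_upwards [hS.ae_eventually, hne 0, hne 1] with t ht h0 h1
  by_cases hI : t ∈ Set.Ioo (0 : ℝ) 1
  · have hfr : ∀ᶠ y in 𝓝 t, Int.fract y = y := by
      filter_upwards [isOpen_Ioo.mem_nhds hI] with y hy
      exact Int.fract_eq_self.2 ⟨hy.1.le, hy.2⟩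
    have hI' : t ∈ Set.Ioc (0 : ℝ) 1 := Set.Ioo_subset_Ioc_self hI
    rcases ht with ht | ht
    · have : stepOf S t = 1 := stepOf_eq_one <| by
        refine Eventually.filter_mono nhdsWithin_le_nhds ?_
        filter_upwards [ht, hfr] with y hy hf
        rwa [hf]
      exact iff_of_true ht.self_of_nhds ⟨hI', this⟩
    · have : stepOf S t = 0 := stepOf_eq_zero <| by
        refine Eventually.filter_mono nhdsWithin_le_nhds ?_
        filter_upwards [ht, hfr] with y hy hf
        rwa [hf]
      refine iff_of_false ht.self_of_nhds fun h => ?_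
      have h' : stepOf S t = 1 := h.2
      omega
  · refine iff_of_false (fun h => hI ?_) fun h => hI ?_
    · exact ⟨lt_of_le_of_ne (h01 h).1 h0.symm, lt_of_le_of_ne (h01 h).2 h1⟩
    · exact ⟨h.1.1, lt_of_le_of_ne h.1.2 h1⟩

end IsFiniteUnionOfIntervals

theorem IsExpRieszBasis.congr_ae {ι : Type*} {freq : ι → ℝ} {S T : Set ℝ}
    (h : S =ᵐ[volume] T) (hT : IsExpRieszBasis freq T) : IsExpRieszBasis freq S := by
  unfold IsExpRieszBasis at hT ⊢
  rwa [Measure.restrict_congr_set h]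

end indicator

theorem mainTheorem7 (K : ℕ) (S : Fin K → Set ℝ)
    (hS : ∀ k, IsFiniteUnionOfIntervals (S k))
    (hmono : Monotone S)
    (h01 : ∀ k, S k ⊆ Set.Icc (0 : ℝ) 1) :
    ∃ Λ : Fin K → Set ℤ, Monotone Λ ∧
      ∀ k, IsExpRieszBasis (fun n : Λ k => ((n : ℤ) : ℝ)) (S k) := by
  obtain ⟨Λ, hΛ, h⟩ := hasNestedBases (fun k => stepOf (S k))
    (fun i j hij t => stepOf_mono (hmono hij) t) (fun k => (hS k).isStep_stepOf)
    fun k t => stepOf_eq_zero_or_one (S k) t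
  refine ⟨Λ, hΛ, fun k => ?_⟩
  exact (isExpRieszBasis_of_rieszPair (hS k).isStep_stepOf.measurable (hS k).stepOf_periodic
    (stepOf_eq_zero_or_one (S k)) (h k)).congr_ae ((hS k).ae_eq_stepOf (h01 k))
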